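/- **Setting.** Two servers $S_0,S_1$ hold additive shares $\langle D\rangle_0,\langle D\rangle_1$ modulo $2^w$ of $m$ nonempty rows $D_0,\dots,D_{m-1}$, row $D_i$ having length $\ell_i\ge 1$ and entries in $\mathbb Z_{2^w}$ (compared as integers in $[0,2^w)$). Server $S_c$ also holds a family $\pi_c$ of permutations, one for each row. *Hybrid model.* The servers may call two ideal functionalities. $\mathcal F_{\mathsf{matrixSharedShuffle}}$ receives $\langle D\rangle_c,\pi_c$ from each $S_c$ and returns a fresh uniformly random additive sharing of the rows permuted first by $\pi_0$ and then by $\pi_1$. $\mathcal F_{\mathsf{packedCompare}}$ receives sharings of $(x_a)_a,(y_a)_a$ and returns fresh uniformly random XOR-sharings of the bits $1\{x_a<y_a\}$. *Protocol $\mathsf{mulRowPartition}$.* The servers first shuffle the rows with $\mathcal F_{\mathsf{matrixSharedShuffle}}$, obtaining shared rows $\langle A\rangle$. Let $p_i$ be the last entry of $A_i$ and $t_i=-1$. For $j=0,\dots,\max_i\ell_i-2$ the servers call $\mathcal F_{\mathsf{packedCompare}}$ once, to compare $A_{i,j}$ with $p_i$ for all $i$ with $j<\ell_i-1$, and reveal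 the result bits to each other by exchanging their shares; for every such $i$ whose bit is $1$ they increase $t_i$ by $1$ and swap the positions $t_i$ and $j$ of $\langle A_i\rangle$. At the end they put $q_i=t_i+1$, swap the positions $q_i$ and $\ell_i-1$ of $\langle A_i\rangle$, and $S_c$ outputs $q=(q_i)_i$ and its share $\langle A\rangle_c$. *Ideal functionality $\mathcal F_{\mathsf{mulRowPartition}}$.* Given the shared rows $D$, it chooses, independently for each row, a uniformly random pivot entry of the row, and rearranges the row uniformly at random among all rearrangements in which exactly the entries to the left of the pivot entry are smaller than it. It gives to $S_c$ the positions $q$ of the pivot entries and its share in a fresh uniformly random sharing of the rearranged rows. **Theorem.** $\mathsf{mulRowPartition}$ is (perfectly) secure in the $(\mathcal F_{\mathsf{packedCompare}},\mathcal F_{\mathsf{matrixSharedShuffle}})$-hybrid model against a static honest-but-curious adversary that corrupts one of the two servers. That is, for each $b\in\{0,1\}$: 1. There is a probabilistic simulator $\mathsf{Sim}_b$, a single program for all parameters, whose number of steps is at most a polynomial in the number of words of its input, such that for all $w,m,(\ell_i)_i$, all input shares $\langle D\rangle_0,\langle D\rangle_1$ and all $\pi_b$, the following two joint distributions are equal: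 (real world, with $\pi_{1-b}$ uniformly random) everything that $S_b$ receives during the protocol, namely its share of the shuffled rows, its shares of all comparison bits and the shares of these bits sent by the other server, together with the outputs of both servers; (ideal world) the outcome of $\mathsf{Sim}_b$, run on the sizes, on the input $\langle D\rangle_b,\pi_b$ of $S_b$ and on the output of $S_b$ from $\mathcal F_{\mathsf{mulRowPartition}}$, together with the outputs of both servers from $\mathcal F_{\mathsf{mulRowPartition}}$. The simulator is a program of a random access machine which adds, subtracts, compares, and samples uniformly from $\{0,\dots,k\}$, all at unit cost. 2. If the entries of each row $D_i$ are pairwise distinct, the output $(q,\langle A\rangle_b)$ that $\mathcal F_{\mathsf{mulRowPartition}}$ gives to $S_b$ is uniformly random on $\prod_i\{0,\dots,\ell_i-1\}\times\prod_i\mathbb Z_{2^w}^{\ell_i}$, whatever the rows are; so what $S_b$ sees can be simulated from random values. -/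

import Mathlib

namespace RowPartition

/-! ### Shared rows

The two servers are indexed by `Bool`: `false` is `S₀` and `true` is `S₁`.
A collection consists of `m` nonempty rows of possibly different lengths; row `i` has
`n i + 1` entries in `ℤ / 2^w`, at the positions `0, …, n i`. -/

/-- A collection of `m` rows of `w`-bit words, the `i`-th of length `n i + 1`. -/
abbrev Rows (w : ℕ) {m : ℕ} (n : Fin m → ℕ) : Type :=
  (i : Fin m) → Fin (n i + 1) → ZMod (2 ^ w)

/-- One permutation of the positions for every row. -/
abbrev RowPerms {m : ℕ} (n : Fin m → ℕ) : Type :=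
  (i : Fin m) → Equiv.Perm (Fin (n i + 1))

/-- One position in every row. -/
abbrev RowIndices {m : ℕ} (n : Fin m → ℕ) : Type :=
  (i : Fin m) → Fin (n i + 1)

instance (w : ℕ) : NeZero (2 ^ w) := ⟨pow_ne_zero w two_ne_zero⟩

noncomputable section

/-- The plaintext of an additive sharing: `⟨x⟩₀ + ⟨x⟩₁ mod 2^w`. -/
def plain {w m : ℕ} {n : Fin m → ℕ} (A : Bool → Rows w n) : Rows w n :=
  fun i k => A false i k + A true i k

/-- A fresh uniformly random additive sharing of `x`. -/
def freshSharing {w m : ℕ} {n : Fin m → ℕ} (x : Rows w n) : PMF (Bool → Rows w n) :=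
  (PMF.uniformOfFintype (Rows w n)).map fun r c => if c then x - r else r

/-! ### The two ideal functionalities of the hybrid model -/

/-- The shuffle functionality. Server `c` supplies its share of the rows and its row
permutations `π c`. The servers receive a fresh sharing of the rows permuted first by
`π₀` and then by `π₁`, where `M` permuted by `π` has the entry `M i (π i k)` at `(i, k)`. -/
def matrixSharedShuffle {w m : ℕ} {n : Fin m → ℕ} (D : Bool → Rows w n)
    (π : Bool → RowPerms n) : PMF (Bool → Rows w n) :=
  freshSharing fun i k => plain D i (π false i (π true i k))

/-- The comparison functionality. From additive sharings of `x` and `y` the servers receive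
fresh Boolean (xor) sharings of the bits `1{x a < y a}`, for unsigned `w`-bit integers. -/
def packedCompare {w : ℕ} {ι : Type} [Fintype ι] [DecidableEq ι]
    (x y : Bool → ι → ZMod (2 ^ w)) : PMF (Bool → ι → Bool) :=
  (PMF.uniformOfFintype (ι → Bool)).map fun r c a =>
    if c then
      xor (r a) (decide ((x false a + x true a).val < (y false a + y true a).val))
    else r a

/-! ### The protocol -/

/-- What both servers learn: the public pivot positions `q`, and a sharing of the rows, of
which server `c` learns `share c`. -/
structure Output (w : ℕ) {m : ℕ} (n : Fin m → ℕ) : Type where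
  q : RowIndices n
  share : Bool → Rows w n

/-- State of an execution. `less i` is the number of entries of row `i` found so far to be
smaller than the pivot, that is, one more than the counter `t i` that starts at `-1`.
`log c` is the list of words that server `c` has received in the comparison rounds. -/
structure ExecState (w : ℕ) {m : ℕ} (n : Fin m → ℕ) : Type where
  share : Bool → Rows w n
  less : Fin m → ℕ
  log : Bool → List ℕ

/-- The rows that take part in round `j`, those with `j < len - 1`. -/
abbrev Active {m : ℕ} (n : Fin m → ℕ) (j : ℕ) : Type := {i : Fin m // j < n i}

/-- Exchange of the entries at the positions `a` and `b` of a row. -/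
def swapEntries {w N : ℕ} (A : Fin (N + 1) → ZMod (2 ^ w)) (a b : ℕ) :
    Fin (N + 1) → ZMod (2 ^ w) :=
  fun k => A (Equiv.swap (Fin.ofNat (N + 1) a) (Fin.ofNat (N + 1) b) k)

/-- The words server `c` receives in round `j`: for each active row, in increasing order,
its own share of the comparison bit (from the comparison functionality) and the share of the
other server (sent to it when the bit is revealed). -/
def roundWords {m : ℕ} {n : Fin m → ℕ} (j : ℕ) (s : Bool → Active n j → Bool)
    (c : Bool) : List ℕ :=
  (List.finRange m).flatMap fun i =>
    if h : j < n i then [(s c ⟨i, h⟩).toNat, (s (!c) ⟨i, h⟩).toNat] else []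

/-- Local computation in round `j`, once the shares `s` of the comparison bits have been
exchanged: in every active row whose revealed bit is `1`, the entry at position `j` is swapped
to the next position on the left, in both shares, and the counter is increased. -/
def afterReveal {w m : ℕ} {n : Fin m → ℕ} (j : ℕ) (st : ExecState w n)
    (s : Bool → Active n j → Bool) : ExecState w n where
  share := fun c i =>
    if h : j < n i then
      if xor (s false ⟨i, h⟩) (s true ⟨i, h⟩) then swapEntries (st.share c i) (st.less i) j
      else st.share c i
    else st.share c i
  less := fun i =>
    if h : j < n i then
      if xor (s false ⟨i, h⟩) (s true ⟨i, h⟩) then st.less i + 1 else st.less i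
    else st.less i
  log := fun c => st.log c ++ roundWords j s c

/-- Round `j`: one call of the comparison functionality for the `j`-th entries of all active
rows against the pivots `p`, revealing of the results, and swapping. -/
def compareRound {w m : ℕ} {n : Fin m → ℕ} (p : Bool → Fin m → ZMod (2 ^ w)) (j : ℕ)
    (st : ExecState w n) : PMF (ExecState w n) :=
  (packedCompare (ι := Active n j)
      (fun c i => st.share c i.1 (Fin.ofNat (n i.1 + 1) j)) (fun c i => p c i.1)).map
    (afterReveal j st)

/-- The first `k` rounds, `j = 0, …, k - 1`. -/
def compareRounds {w m : ℕ} {n : Fin m → ℕ} (p : Bool → Fin m → ZMod (2 ^ w)) :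
    ℕ → ExecState w n → PMF (ExecState w n)
  | 0, st => PMF.pure st
  | k + 1, st => (compareRounds p k st).bind (compareRound p k)

/-- The partition protocol on shared rows `A`. The pivot of a row is its last entry. The
number of rounds is the maximal length minus one; at the end the pivots are swapped into
place. The result is the final output and, for each server, the words received. -/
def mulRowPartition {w m : ℕ} {n : Fin m → ℕ} (A : Bool → Rows w n) :
    PMF (Output w n × (Bool → List ℕ)) :=
  (compareRounds (fun c i => A c i (Fin.last (n i))) (Finset.univ.sup n)
      { share := A, less := fun _ => 0, log := fun _ => [] }).map fun st =>
    ({ q := fun i => Fin.ofNat (n i + 1) (st.less i)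
       share := fun c i => swapEntries (st.share c i) (st.less i) (n i) }, st.log)

/-! ### Words -/

/-- The entries of all rows, row by row, as natural numbers. -/
def rowWords {w m : ℕ} {n : Fin m → ℕ} (A : Rows w n) : List ℕ :=
  (List.finRange m).flatMap fun i => List.ofFn fun k => (A i k).val

/-- The images of all row permutations, row by row. -/
def permWords {m : ℕ} {n : Fin m → ℕ} (π : RowPerms n) : List ℕ :=
  (List.finRange m).flatMap fun i => List.ofFn fun k => (π i k).val

/-! ### Real execution -/

/-- The real execution in the hybrid model, with server `b` corrupted (honest but curious).
`D c` is the input share of server `c`, and `πb` is the permutation of server `b`. The honest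
server picks its own permutation uniformly at random. The rows are shuffled by the shuffle
functionality and then partitioned. The result consists of everything that server `b` receives
(its share of the shuffled rows, then the words of the comparison rounds) and the output of
both servers. -/
def realWorld {w m : ℕ} {n : Fin m → ℕ} (b : Bool) (D : Bool → Rows w n) (πb : RowPerms n) :
    PMF (List ℕ × Output w n) :=
  (PMF.uniformOfFintype (RowPerms n)).bind fun πh =>
    (matrixSharedShuffle D fun c => if c = b then πb else πh).bind fun A =>
      (mulRowPartition A).map fun e => (rowWords (A b) ++ e.2 b, e.1)

/-! ### The ideal functionality of the partition protocol -/

/-- The rearrangement `x ∘ ρ` of the row `x` is partitioned around the entry `k`, which stands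
at the position `ρ⁻¹ k`: the entries to the left of it, and no others, are smaller. -/
def IsPartition {w N : ℕ} (x : Fin (N + 1) → ZMod (2 ^ w)) (k : Fin (N + 1))
    (ρ : Equiv.Perm (Fin (N + 1))) : Prop :=
  ∀ j, (x (ρ j)).val < (x k).val ↔ j < ρ.symm k

theorem exists_isPartition {w N : ℕ} (x : Fin (N + 1) → ZMod (2 ^ w)) (k : Fin (N + 1)) :
    ∃ ρ, IsPartition x k ρ := by
  classical
  let f : Fin (N + 1) → ℕ := fun a => if (x a).val < (x k).val then 0 else if a = k then 1 else 2
  have hm : Monotone (f ∘ Tuple.sort f) := Tuple.monotone_sort f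
  have hk : f k = 1 := by simp [f]
  refine ⟨Tuple.sort f, fun j => ⟨fun h => ?_, fun h => ?_⟩⟩
  · by_contra hj
    have h1 := hm (not_lt.mp hj)
    have h2 : f (Tuple.sort f j) = 0 := by simp [f, h]
    simp only [Function.comp, Equiv.apply_symm_apply, hk, h2] at h1
    omega
  · have h1 := hm h.le
    simp only [Function.comp, Equiv.apply_symm_apply, hk] at h1
    by_contra hx
    have hne : Tuple.sort f j ≠ k := fun e => h.ne ((Equiv.eq_symm_apply _).mpr e)
    simp [f, hx, hne] at h1

open Classical in
/-- The families of rearrangements that partition every row `x i` around its entry `k i`. -/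
def partitions {w m : ℕ} {n : Fin m → ℕ} (x : Rows w n) (k : RowIndices n) :
    Finset (RowPerms n) :=
  Finset.univ.filter fun ρ => ∀ i, IsPartition (x i) (k i) (ρ i)

theorem partitions_nonempty {w m : ℕ} {n : Fin m → ℕ} (x : Rows w n) (k : RowIndices n) :
    (partitions x k).Nonempty :=
  ⟨fun i => (exists_isPartition (x i) (k i)).choose, by
    simpa [partitions] using fun i => (exists_isPartition (x i) (k i)).choose_spec⟩

/-- The ideal functionality: in every row a uniformly random pivot entry `k i` is chosen, the
row is rearranged uniformly at random among the rearrangements partitioned around that entry,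
and the servers receive the positions of the pivots and a fresh sharing of the new rows. -/
def idealPartition {w m : ℕ} {n : Fin m → ℕ} (D : Bool → Rows w n) : PMF (Output w n) :=
  (PMF.uniformOfFintype (RowIndices n)).bind fun k =>
    (PMF.uniformOfFinset (partitions (plain D) k) (partitions_nonempty (plain D) k)).bind
      fun ρ => (freshSharing fun i j => plain D i (ρ i j)).map fun s =>
        { q := fun i => (ρ i).symm (k i), share := s }

/-! ### Probabilistic programs with a step count

A random access machine with registers, a memory with indirect addressing, a read-only input,
an append-only output, uniform sampling, and structured control flow. Every instruction and
every test costs one step. Numbers are changed by addition and subtraction only, so their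
bit length grows by at most one per step. -/

/-- Programs; the arguments are register numbers, except for the constant `a` in `const x a`. -/
inductive Prog : Type where
  | const (x a : ℕ)
  | add (x y z : ℕ)
  | sub (x y z : ℕ)
  | read (x y : ℕ)
  | load (x y : ℕ)
  | store (x y : ℕ)
  | rand (x y : ℕ)
  | emit (x : ℕ)
  | seq (p q : Prog)
  | ifLe (x y : ℕ) (p q : Prog)
  | loop (x : ℕ) (p : Prog)

/-- Machine states. -/
structure Mach : Type where
  reg : ℕ → ℕ
  mem : ℕ → ℕ
  out : List ℕ
  steps : ℕ

/-- Assignment to register `x`, in one step. -/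
def Mach.setReg (s : Mach) (x v : ℕ) : Mach :=
  { s with reg := Function.update s.reg x v, steps := s.steps + 1 }

/-- `k`-fold repetition of a probabilistic step. -/
def repeatStep {α : Type} (f : α → PMF α) : ℕ → α → PMF α
  | 0, a => PMF.pure a
  | k + 1, a => (f a).bind (repeatStep f k)

/-- Execution of a program on a read-only input. `sub` is truncated at `0`, `read` gives `0`
beyond the end of the input, `rand x y` draws a uniformly random number in
`{0, …, reg y}`, and `loop x p` repeats `p` as often as `reg x` says at its start. -/
def Prog.exec (input : List ℕ) : Prog → Mach → PMF Mach
  | .const x a, s => PMF.pure (s.setReg x a)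
  | .add x y z, s => PMF.pure (s.setReg x (s.reg y + s.reg z))
  | .sub x y z, s => PMF.pure (s.setReg x (s.reg y - s.reg z))
  | .read x y, s => PMF.pure (s.setReg x (input.getD (s.reg y) 0))
  | .load x y, s => PMF.pure (s.setReg x (s.mem (s.reg y)))
  | .store x y, s => PMF.pure
      { s with mem := Function.update s.mem (s.reg x) (s.reg y), steps := s.steps + 1 }
  | .rand x y, s => (PMF.uniformOfFintype (Fin (s.reg y + 1))).map fun v => s.setReg x v.val
  | .emit x, s => PMF.pure { s with out := s.out ++ [s.reg x], steps := s.steps + 1 }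
  | .seq p q, s => (p.exec input s).bind (q.exec input)
  | .ifLe x y p q, s =>
      if s.reg x ≤ s.reg y then p.exec input { s with steps := s.steps + 1 }
      else q.exec input { s with steps := s.steps + 1 }
  | .loop x p, s => repeatStep (p.exec input) (s.reg x) { s with steps := s.steps + 1 }

/-- Execution from the blank state. -/
def Prog.run (p : Prog) (input : List ℕ) : PMF Mach :=
  p.exec input { reg := fun _ => 0, mem := fun _ => 0, out := [], steps := 0 }

/-- Every run of `p` on `input` takes at most `T` steps. -/
def Prog.RunsWithin (p : Prog) (input : List ℕ) (T : ℕ) : Prop :=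
  ∀ s ∈ (p.run input).support, s.steps ≤ T

/-! ### Ideal execution -/

/-- What a simulator for server `b` is given: the public sizes, the input of server `b`
(its share of the rows and its permutations), and the output of server `b`. -/
def simInput {w m : ℕ} {n : Fin m → ℕ} (b : Bool) (D : Bool → Rows w n) (πb : RowPerms n)
    (o : Output w n) : List ℕ :=
  [w, m] ++ List.ofFn n ++ rowWords (D b) ++ permWords πb ++
    (List.ofFn fun i => (o.q i).val) ++ rowWords (o.share b)

/-- The ideal execution: the ideal functionality determines the output of both servers, and
the simulator produces what server `b` receives, from the input and the output of server `b`. -/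
def idealWorld {w m : ℕ} {n : Fin m → ℕ} (sim : Prog) (b : Bool) (D : Bool → Rows w n)
    (πb : RowPerms n) : PMF (List ℕ × Output w n) :=
  (idealPartition D).bind fun o =>
    (sim.run (simInput b D πb o)).map fun s => (s.out, o)

end

end RowPartition

/-!
The swaps of the protocol act in the same way on both shares, and they depend only on the revealed
comparison bits. For a row of length `N + 1` let `B` be the set of the rounds whose bit is `1`. The
protocol turns the row `A` into `A ∘ protocolPerm N B`, and the pivot ends at the position `#B`.
Hence a server that knows its share of the output and the sets `B` of all rows can undo the swaps
and recover its share of the shuffled rows. The only other words it receives are the shares of the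
bits: its own share of each bit is a fair coin, and the share of the other server is the exclusive
or of that coin and the bit (`roundLog_eq`). So it is enough to sample the sets `B` correctly.

Since the honest server permutes at random, the joint shuffle `σ` of a row `x` is a uniformly
random permutation. The pivot entry is `k = σ (last)`, and `ρ = σ ∘ protocolPerm N B` is a
rearrangement partitioned around `k`. For fixed `k`, the map `σ ↦ (ρ, B)` is a bijection from the
permutations with `σ (last) = k` to the pairs of a partitioned rearrangement `ρ` and a subset `B` of
the `N` rounds with as many elements as there are entries to the left of the pivot
(`isPartition_of_shuffle`, `shuffle_of_isPartition`). The number of permutations with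
`σ (last) = k` does not depend on `k`. Therefore `k`, and then `ρ` given `k`, have the distribution
of the ideal functionality, and given both `B` is uniformly random among the sets of size `q`, the
position of the pivot (`uniform_shuffle`, `realWorld_eq`).

The simulator runs through the rounds of each row from the last to the first. When `r` ones are to
be distributed over the rounds `0, …, j`, the bit of round `j` is `1` with probability
`r / (j + 1)`, which makes `B` uniform (`subsetPMF_eq`); if it is `1`, the swap of the round is
undone at once, with `r - 1` as the counter. Correctness and running time of the program are proved
together, by a coupling of the machine with the distribution that it has to produce
(`Simulator.program_coupled`), built up from invariant rules for loops.

If the entries of each row are distinct, the position of the pivot is the rank of the pivot entry,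
a bijective function of the uniformly random `k`, and one share of a fresh sharing is uniform
whatever is shared (`idealPartition_map_uniform`).
-/

namespace RowPartition

open scoped ENNReal

/-! ### Uniform distributions -/

/-- A distribution that is constant on `s` and vanishes elsewhere is the uniform one; the constant
need not be known. -/
theorem eq_uniformOfFinset {α : Type} {s : Finset α} (hs : s.Nonempty) (μ : PMF α) (c : ℝ≥0∞)
    (h1 : ∀ a ∈ s, μ a = c) (h0 : ∀ a ∉ s, μ a = 0) : μ = PMF.uniformOfFinset s hs := by
  have h := μ.tsum_coe
  rw [tsum_eq_sum (s := s) h0, Finset.sum_congr rfl h1, Finset.sum_const, nsmul_eq_mul] at h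
  have hc : c = (s.card : ℝ≥0∞)⁻¹ := by
    rw [mul_comm] at h
    exact ENNReal.eq_inv_of_mul_eq_one_left h
  ext a
  by_cases ha : a ∈ s
  · rw [h1 a ha, PMF.uniformOfFinset_apply_of_mem hs ha, hc]
  · rw [h0 a ha, PMF.uniformOfFinset_apply_of_notMem hs ha]

/-- Two uniform choices in succession make one uniform choice from `u`, provided that the number
of possibilities for the second does not depend on the first, and that the results enumerate `u`
without repetition. -/
theorem uniform_bind_map_uniform {α β γ : Type} {s : Finset α} (hs : s.Nonempty)
    {t : α → Finset β} (ht : ∀ a, (t a).Nonempty) (f : α → β → γ) {u : Finset γ}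
    (hu : u.Nonempty) (c : ℕ) (hc : ∀ a ∈ s, (t a).card = c)
    (hmaps : ∀ a ∈ s, ∀ b ∈ t a, f a b ∈ u)
    (hbij : ∀ g ∈ u, ∃ a ∈ s, ∃ b ∈ t a, f a b = g ∧
      ∀ a' ∈ s, ∀ b' ∈ t a', f a' b' = g → a' = a ∧ b' = b) :
    ((PMF.uniformOfFinset s hs).bind fun a => (PMF.uniformOfFinset (t a) (ht a)).map (f a)) =
      PMF.uniformOfFinset u hu := by
  classical
  refine eq_uniformOfFinset hu _ ((s.card : ℝ≥0∞)⁻¹ * (c : ℝ≥0∞)⁻¹) (fun g hg => ?_)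
    (fun g hg => ?_)
  · obtain ⟨a, ha, b, hb, hab, huniq⟩ := hbij g hg
    rw [PMF.bind_apply, tsum_eq_single a, PMF.uniformOfFinset_apply_of_mem hs ha, PMF.map_apply,
      tsum_eq_single b, if_pos hab.symm, PMF.uniformOfFinset_apply_of_mem _ hb, hc a ha]
    · intro b' hb'
      split_ifs with h
      · by_contra hne
        have : b' ∈ t a := (PMF.mem_support_uniformOfFinset_iff (ht a) b').1 hne
        exact hb' (huniq a ha b' this h.symm).2
      · rfl
    · intro a' ha'
      by_contra hne
      obtain ⟨h1, h2⟩ := mul_ne_zero_iff.1 hne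
      have h1' := (PMF.mem_support_uniformOfFinset_iff hs a').1 h1
      obtain ⟨b', hb', e⟩ := (PMF.mem_support_map_iff _ _ _).1 h2
      exact ha' (huniq a' h1' b' ((PMF.mem_support_uniformOfFinset_iff _ b').1 hb') e).1
  · by_contra hne
    obtain ⟨a, ha, hb⟩ := (PMF.mem_support_bind_iff _ _ _).1 hne
    obtain ⟨b, hb, e⟩ := (PMF.mem_support_map_iff _ _ _).1 hb
    have ha := (PMF.mem_support_uniformOfFinset_iff hs a).1 ha
    have hb := (PMF.mem_support_uniformOfFinset_iff _ b).1 hb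
    exact hg (e ▸ hmaps a ha b hb)

theorem uniformOfFintype_map_equiv {α β : Type} [Fintype α] [Nonempty α] [Fintype β] [Nonempty β]
    (e : α ≃ β) : (PMF.uniformOfFintype α).map e = PMF.uniformOfFintype β := by
  classical
  ext b
  rw [PMF.map_apply, tsum_eq_single (e.symm b)]
  · simp [Fintype.card_congr e]
  · intro a ha
    rw [if_neg]
    rintro rfl
    simp at ha

theorem bind_congr_support {α β : Type} (μ : PMF α) {f g : α → PMF β}
    (h : ∀ a ∈ μ.support, f a = g a) : μ.bind f = μ.bind g := by
  ext b
  rw [PMF.bind_apply, PMF.bind_apply]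
  refine tsum_congr fun a => ?_
  by_cases ha : μ a = 0
  · simp [ha]
  · rw [h a ha]

/-! ### Couplings -/

/-- `μ` and `ν` have a coupling that is concentrated on the relation `R`. -/
def Coupled {α β : Type} (μ : PMF α) (ν : PMF β) (R : α → β → Prop) : Prop :=
  ∃ κ : PMF (α × β), κ.map Prod.fst = μ ∧ κ.map Prod.snd = ν ∧ ∀ x ∈ κ.support, R x.1 x.2

namespace Coupled

variable {α β γ δ : Type}

theorem pure {R : α → β → Prop} {a : α} {b : β} (h : R a b) :
    Coupled (PMF.pure a) (PMF.pure b) R :=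
  ⟨PMF.pure (a, b), by simp [PMF.pure_map], by simp [PMF.pure_map], by simpa using h⟩

theorem mono {μ : PMF α} {ν : PMF β} {R S : α → β → Prop} (h : Coupled μ ν R)
    (hRS : ∀ a b, R a b → S a b) : Coupled μ ν S := by
  obtain ⟨κ, h1, h2, h3⟩ := h
  exact ⟨κ, h1, h2, fun x hx => hRS _ _ (h3 x hx)⟩

theorem bind {μ : PMF α} {ν : PMF β} {R : α → β → Prop} {f : α → PMF γ} {g : β → PMF δ}
    {S : γ → δ → Prop} (h : Coupled μ ν R) (hfg : ∀ a b, R a b → Coupled (f a) (g b) S) :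
    Coupled (μ.bind f) (ν.bind g) S := by
  obtain ⟨κ, rfl, rfl, h3⟩ := h
  -- Pairs outside `R` have no mass; the independent coupling serves for them.
  have key : ∀ x : α × β, ∃ κ' : PMF (γ × δ), κ'.map Prod.fst = f x.1 ∧ κ'.map Prod.snd = g x.2 ∧
      (R x.1 x.2 → ∀ y ∈ κ'.support, S y.1 y.2) := by
    intro x
    by_cases hx : R x.1 x.2
    · obtain ⟨κ', a, b, c⟩ := hfg _ _ hx
      exact ⟨κ', a, b, fun _ => c⟩
    · refine ⟨(f x.1).bind fun c => (g x.2).map fun d => (c, d), ?_, ?_, fun h => absurd h hx⟩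
      · simp only [PMF.map_bind, PMF.map_comp]
        exact (congrArg _ (funext fun c => PMF.map_const (g x.2) c)).trans (PMF.bind_pure _)
      · simp [PMF.map_bind, PMF.map_comp, Function.comp_def]
        exact PMF.map_id _
  choose κ' h1 h2 h4 using key
  refine ⟨κ.bind κ', ?_, ?_, fun y hy => ?_⟩
  · simp only [PMF.map_bind, PMF.bind_map, Function.comp_def, h1]
  · simp only [PMF.map_bind, PMF.bind_map, Function.comp_def, h2]
  · obtain ⟨x, hx, hy⟩ := (PMF.mem_support_bind_iff _ _ _).1 hy
    exact h4 x (h3 x hx) y hy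

theorem refl (μ : PMF α) : Coupled μ μ Eq := by
  refine ⟨μ.map fun a => (a, a), ?_, ?_, fun x hx => ?_⟩
  · rw [PMF.map_comp]; exact PMF.map_id μ
  · rw [PMF.map_comp]; exact PMF.map_id μ
  · obtain ⟨a, -, rfl⟩ := (PMF.mem_support_map_iff _ _ _).1 hx
    rfl

theorem map_left {μ : PMF α} {ν : PMF β} {S : γ → β → Prop} {f : α → γ}
    (h : Coupled μ ν fun a b => S (f a) b) : Coupled (μ.map f) ν S := by
  have := h.bind (f := fun a => PMF.pure (f a)) (g := PMF.pure) (S := S)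
    fun a b hab => Coupled.pure hab
  rwa [PMF.bind_pure] at this

theorem map_right {μ : PMF α} {ν : PMF β} {S : α → γ → Prop} {f : β → γ}
    (h : Coupled μ ν fun a b => S a (f b)) : Coupled μ (ν.map f) S := by
  have := h.bind (f := PMF.pure) (g := fun a => PMF.pure (f a)) (S := S)
    fun a b hab => Coupled.pure hab
  rwa [PMF.bind_pure] at this

theorem map_eq {μ : PMF α} {ν : PMF β} {R : α → β → Prop} (h : Coupled μ ν R)
    (f : α → γ) (g : β → γ) (hR : ∀ a b, R a b → f a = g b) : μ.map f = ν.map g := by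
  obtain ⟨κ, rfl, rfl, h3⟩ := h
  rw [PMF.map_comp, PMF.map_comp, PMF.map, PMF.map]
  exact bind_congr_support _ fun x hx => congrArg PMF.pure (hR _ _ (h3 x hx))

theorem forall_right {μ : PMF α} {ν : PMF β} {R : α → β → Prop} (h : Coupled μ ν R) {b : β}
    (hb : b ∈ ν.support) : ∃ a, R a b := by
  obtain ⟨κ, rfl, rfl, h3⟩ := h
  obtain ⟨x, hx, rfl⟩ := (PMF.mem_support_map_iff _ _ _).1 hb
  exact ⟨x.1, h3 x hx⟩

end Coupled

/-! ### Loops and independent choices -/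

/-- A loop may be unrolled at its end, so that invariants can be established by induction. -/
theorem repeatStep_succ_last {α : Type} (f : α → PMF α) (k : ℕ) (a : α) :
    repeatStep f (k + 1) a = (repeatStep f k a).bind f := by
  induction k generalizing a with
  | zero => simp [repeatStep]
  | succ k ih =>
    rw [repeatStep, repeatStep, PMF.bind_bind]
    exact congrArg _ (funext fun b => ih b)

/-- Invariant rule for a loop whose body makes no random choice. -/
theorem repeatStep_pure {α : Type} {f : α → PMF α} {I : ℕ → α → Prop} {k : ℕ} {a : α}
    (h0 : I 0 a) (hs : ∀ i a, i < k → I i a → ∃ a', f a = PMF.pure a' ∧ I (i + 1) a') :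
    ∃ a', repeatStep f k a = PMF.pure a' ∧ I k a' := by
  induction k with
  | zero => exact ⟨a, rfl, h0⟩
  | succ k ih =>
    obtain ⟨a', h1, h2⟩ := ih fun i a hi => hs i a (hi.trans k.lt_succ_self)
    obtain ⟨a'', h3, h4⟩ := hs k a' k.lt_succ_self h2
    exact ⟨a'', by rw [repeatStep_succ_last, h1, PMF.pure_bind, h3], h4⟩

/-- `m` independent choices, the `i`-th from `t i`. The value at all places from `m` on is `d`. -/
noncomputable def seqPMF {α : Type} (d : α) (t : ℕ → PMF α) : ℕ → PMF (ℕ → α)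
  | 0 => PMF.pure fun _ => d
  | m + 1 => (seqPMF d t m).bind fun f => (t m).map fun b => Function.update f m b

/-- Invariant rule for a loop whose `i`-th iteration makes a choice from `t i`. -/
theorem coupled_seqPMF {α β : Type} {d : α} {t : ℕ → PMF α} {f : β → PMF β}
    {R : ℕ → (ℕ → α) → β → Prop} {k : ℕ} {b : β} (h0 : R 0 (fun _ => d) b)
    (hs : ∀ i F b, i < k → R i F b →
      Coupled (t i) (f b) fun x b' => R (i + 1) (Function.update F i x) b') :
    Coupled (seqPMF d t k) (repeatStep f k b) (R k) := by
  induction k with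
  | zero => exact Coupled.pure h0
  | succ k ih =>
    rw [repeatStep_succ_last, seqPMF]
    exact (ih fun i F b hi => hs i F b (hi.trans k.lt_succ_self)).bind fun F b h =>
      (hs k F b k.lt_succ_self h).map_left

/-- Independent uniform choices from the sets `S i` are a uniform choice from their product. -/
theorem seqPMF_map_uniform {α : Type} [DecidableEq α] (d : α) (S : ℕ → Finset α)
    (hS : ∀ i, (S i).Nonempty) (m : ℕ) (hne : (Fintype.piFinset fun i : Fin m => S i).Nonempty) :
    (seqPMF d (fun i => PMF.uniformOfFinset (S i) (hS i)) m).map (fun f (i : Fin m) => f i) =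
      PMF.uniformOfFinset (Fintype.piFinset fun i : Fin m => S i) hne := by
  induction m with
  | zero =>
    refine eq_uniformOfFinset hne _ 1 (fun a _ => ?_) (fun a ha => ?_)
    · rw [seqPMF, PMF.pure_map, PMF.pure_apply, if_pos (Subsingleton.elim _ _)]
    · exact absurd (Fintype.mem_piFinset.2 fun i => i.elim0) ha
  | succ m ih =>
    have hne' : (Fintype.piFinset fun i : Fin m => S i).Nonempty :=
      Fintype.piFinset_nonempty.2 fun i => hS i
    have e : ((seqPMF d (fun i => PMF.uniformOfFinset (S i) (hS i)) m).map
          (fun f (i : Fin m) => f i)).bind (fun a =>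
            (PMF.uniformOfFinset (S m) (hS m)).map fun b => (Fin.snoc a b : Fin (m + 1) → α)) =
        (seqPMF d (fun i => PMF.uniformOfFinset (S i) (hS i)) (m + 1)).map
          (fun f (i : Fin (m + 1)) => f i) := by
      rw [seqPMF, PMF.bind_map, PMF.map_bind]
      refine congrArg _ (funext fun f => ?_)
      rw [PMF.map_comp]
      refine congrArg (fun g => PMF.map g _) (funext fun b => funext fun i => ?_)
      induction i using Fin.lastCases with
      | last => simp
      | cast i => simp [Function.update_of_ne i.2.ne]
    rw [← e, ih hne']
    refine uniform_bind_map_uniform hne' (fun _ => hS m) (fun a b => Fin.snoc a b) hne _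
      (fun _ _ => rfl) (fun a ha b hb => ?_) (fun g hg => ?_)
    · rw [Fintype.mem_piFinset] at ha ⊢
      intro i
      induction i using Fin.lastCases with
      | last => simpa using hb
      | cast i => simpa using ha i
    · rw [Fintype.mem_piFinset] at hg
      refine ⟨Fin.init g, Fintype.mem_piFinset.2 fun i => hg i.castSucc,
        g (Fin.last m), hg (Fin.last m), Fin.snoc_init_self g, ?_⟩
      rintro a' - b' - rfl
      simp

/-! ### Sequential sampling of subsets -/

/-- A random subset of `{0, …, n - 1}` with `R` elements, sampled from the top: the element `n - 1`
is taken with probability `R / n`, then the rest is a random subset of `{0, …, n - 2}`. -/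
noncomputable def subsetPMF : ℕ → ℕ → PMF (Finset ℕ)
  | 0, _ => PMF.pure ∅
  | n + 1, R => (PMF.uniformOfFintype (Fin (n + 1))).bind fun v =>
      if v.val < R then (subsetPMF n (R - 1)).map (insert n) else subsetPMF n R

theorem sum_fin_ite_lt {N R : ℕ} (h : R ≤ N) (a b : ℝ≥0∞) :
    (∑ v : Fin N, if v.val < R then a else b) = R * a + (N - R : ℕ) * b := by
  obtain ⟨d, rfl⟩ := Nat.exists_eq_add_of_le h
  rw [Fin.sum_univ_eq_sum_range (fun v => if v < R then a else b), Finset.sum_range_add,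
    Finset.sum_congr rfl fun i hi => if_pos (Finset.mem_range.1 hi)]
  simp

theorem natCast_mul_inv_mul_inv {a b c d : ℕ} (ha : a ≠ 0) (h : b * a = c * d) :
    (a : ℝ≥0∞) * ((c : ℝ≥0∞)⁻¹ * (d : ℝ≥0∞)⁻¹) = (b : ℝ≥0∞)⁻¹ := by
  have h' : (a : ℝ≥0∞) * b = c * d := by rw [mul_comm]; exact_mod_cast h
  have ha' : (a : ℝ≥0∞) ≠ 0 := by exact_mod_cast ha
  rw [← ENNReal.mul_inv (.inr (ENNReal.natCast_ne_top _)) (.inl (ENNReal.natCast_ne_top _)), ← h',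
    ENNReal.mul_inv (.inl ha') (.inl (ENNReal.natCast_ne_top _)), ← mul_assoc,
    ENNReal.mul_inv_cancel ha' (ENNReal.natCast_ne_top _), one_mul]

theorem powersetCard_range_nonempty {n R : ℕ} (h : R ≤ n) :
    (Finset.powersetCard R (Finset.range n)).Nonempty :=
  Finset.powersetCard_nonempty.2 (by simpa using h)

/-- Sampling a subset from the top gives all subsets with `R` elements the same probability, by the
recursions `(n + 1) * choose n R = (R + 1) * choose (n + 1) (R + 1)` and
`(n + 1) * choose n R = (n + 1 - R) * choose (n + 1) R`. -/
theorem subsetPMF_eq (n R : ℕ) (h : R ≤ n) :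
    subsetPMF n R = PMF.uniformOfFinset (Finset.powersetCard R (Finset.range n))
      (powersetCard_range_nonempty h) := by
  induction n generalizing R with
  | zero =>
    obtain rfl : R = 0 := by omega
    refine eq_uniformOfFinset _ _ 1 (fun a ha => ?_) (fun a ha => ?_)
    · simp at ha; simp [subsetPMF, ha]
    · simp at ha; simp [subsetPMF, ha]
  | succ n ih =>
    refine eq_uniformOfFinset _ _ ((n + 1).choose R : ℝ≥0∞)⁻¹ (fun B hB => ?_) (fun B hB => ?_)
    · rw [Finset.mem_powersetCard] at hB
      obtain ⟨hB1, hB2⟩ := hB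
      have hRn : R ≤ n + 1 := h
      have e : ∀ v : Fin (n + 1), PMF.uniformOfFintype (Fin (n + 1)) v *
          (if v.val < R then (subsetPMF n (R - 1)).map (insert n) else subsetPMF n R) B =
          if v.val < R then ((n + 1 : ℕ) : ℝ≥0∞)⁻¹ * ((subsetPMF n (R - 1)).map (insert n)) B
          else ((n + 1 : ℕ) : ℝ≥0∞)⁻¹ * subsetPMF n R B := by
        intro v
        rw [PMF.uniformOfFintype_apply, Fintype.card_fin]
        split_ifs <;> rfl
      rw [subsetPMF, PMF.bind_apply, tsum_fintype, Finset.sum_congr rfl fun v _ => e v,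
        sum_fin_ite_lt hRn]
      by_cases hn : n ∈ B
      · obtain ⟨R, rfl⟩ : ∃ R', R = R' + 1 :=
          Nat.exists_eq_succ_of_ne_zero (by rw [← hB2]; exact (Finset.card_pos.2 ⟨n, hn⟩).ne')
        have h1 : ((subsetPMF n R).map (insert n)) B = (n.choose R : ℝ≥0∞)⁻¹ := by
          rw [ih _ (by omega), PMF.map_apply, tsum_eq_single (B.erase n),
            if_pos (Finset.insert_erase hn).symm, PMF.uniformOfFinset_apply_of_mem,
            Finset.card_powersetCard, Finset.card_range]
          · rw [Finset.mem_powersetCard, Finset.card_erase_of_mem hn, hB2]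
            refine ⟨fun x hx => ?_, rfl⟩
            have h1 := Finset.mem_erase.1 hx
            have h2 := Finset.mem_range.1 (hB1 h1.2)
            exact Finset.mem_range.2 (by have := h1.1; omega)
          · intro B' hB'
            by_contra hne
            simp only [ite_eq_right_iff, not_forall] at hne
            obtain ⟨rfl, hne⟩ := hne
            have := (PMF.mem_support_uniformOfFinset_iff _ _).1 hne
            have hn' : n ∉ B' := fun hn' => by
              simpa using (Finset.mem_powersetCard.1 this).1 hn'
            exact hB' (Finset.erase_insert hn').symm
        have h2 : ((n + 1 - (R + 1) : ℕ) : ℝ≥0∞) *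
            (((n + 1 : ℕ) : ℝ≥0∞)⁻¹ * subsetPMF n (R + 1) B) = 0 := by
          by_cases hR : R + 1 ≤ n
          · rw [ih _ hR, PMF.uniformOfFinset_apply_of_notMem]
            · simp
            · intro hB
              simpa using (Finset.mem_powersetCard.1 hB).1 hn
          · rw [show n + 1 - (R + 1) = 0 by omega]; simp
        rw [Nat.add_sub_cancel, h1, h2, add_zero]
        exact natCast_mul_inv_mul_inv R.succ_ne_zero (Nat.add_one_mul_choose_eq n R).symm
      · have hBn : B ⊆ Finset.range n := fun x hx => by
          have h1 := Finset.mem_range.1 (hB1 hx)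
          have : x ≠ n := fun e => hn (e ▸ hx)
          exact Finset.mem_range.2 (by omega)
        have hR : R ≤ n := by
          simpa [hB2] using Finset.card_le_card hBn
        have h1 : ((subsetPMF n (R - 1)).map (insert n)) B = 0 := by
          by_contra hne
          obtain ⟨B', -, rfl⟩ := (PMF.mem_support_map_iff _ _ _).1 hne
          exact hn (Finset.mem_insert_self _ _)
        rw [h1, mul_zero, mul_zero, zero_add, ih _ hR, PMF.uniformOfFinset_apply_of_mem,
          Finset.card_powersetCard, Finset.card_range]
        · exact natCast_mul_inv_mul_inv (by omega)
            (by rw [← Nat.choose_mul_succ_eq, mul_comm])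
        · exact Finset.mem_powersetCard.2 ⟨hBn, hB2⟩
    · by_contra hne
      apply hB
      obtain ⟨v, -, hv⟩ := (PMF.mem_support_bind_iff _ _ _).1 hne
      split_ifs at hv with hvR
      · obtain ⟨B', hB', rfl⟩ := (PMF.mem_support_map_iff _ _ _).1 hv
        rw [ih _ (by omega), PMF.mem_support_uniformOfFinset_iff, Finset.mem_powersetCard] at hB'
        rw [Finset.mem_powersetCard, Finset.card_insert_of_notMem, hB'.2, Finset.range_add_one]
        · exact ⟨Finset.insert_subset_insert _ hB'.1, by omega⟩
        · intro hn; simpa using hB'.1 hn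
      · have hRn : R ≤ n := by have := v.2; omega
        rw [ih _ hRn, PMF.mem_support_uniformOfFinset_iff, Finset.mem_powersetCard] at hv
        exact Finset.mem_powersetCard.2
          ⟨hv.1.trans (Finset.range_subset_range.2 n.le_succ), hv.2⟩

/-! ### The permutation performed by the rounds -/

/-- The number of elements of `B` below `k`. -/
def countBelow (B : Finset ℕ) (k : ℕ) : ℕ := (B.filter (· < k)).card

theorem countBelow_zero (B : Finset ℕ) : countBelow B 0 = 0 := by simp [countBelow]

theorem countBelow_succ (B : Finset ℕ) (k : ℕ) :
    countBelow B (k + 1) = countBelow B k + if k ∈ B then 1 else 0 := by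
  unfold countBelow
  split_ifs with h
  · rw [← Finset.card_insert_of_notMem (s := B.filter (· < k)) (a := k) (by simp)]
    congr 1
    ext x
    simp only [Finset.mem_filter, Finset.mem_insert]
    constructor
    · rintro ⟨h1, h2⟩
      by_cases e : x = k
      · exact .inl e
      · exact .inr ⟨h1, by omega⟩
    · rintro (rfl | ⟨h1, h2⟩)
      · exact ⟨h, by omega⟩
      · exact ⟨h1, by omega⟩
  · rw [add_zero]
    congr 1
    refine Finset.filter_congr fun x hx => ?_
    have : x ≠ k := fun e => h (e ▸ hx)
    omega

theorem countBelow_le (B : Finset ℕ) (k : ℕ) : countBelow B k ≤ k := by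
  induction k with
  | zero => exact (countBelow_zero B).le
  | succ k ih => rw [countBelow_succ]; split_ifs <;> omega

theorem countBelow_eq_card {B : Finset ℕ} {k : ℕ} (h : B ⊆ Finset.range k) :
    countBelow B k = B.card := by
  unfold countBelow
  rw [Finset.filter_true_of_mem fun x hx => Finset.mem_range.1 (h hx)]

theorem countBelow_congr {B C : Finset ℕ} {k : ℕ} (h : ∀ x < k, x ∈ B ↔ x ∈ C) :
    countBelow B k = countBelow C k := by
  unfold countBelow
  congr 1
  ext x
  simp only [Finset.mem_filter]
  exact ⟨fun hx => ⟨(h x hx.2).1 hx.1, hx.2⟩, fun hx => ⟨(h x hx.2).2 hx.1, hx.2⟩⟩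

/-- The swap of round `k` in a row of length `N + 1`, when `B` is the set of the rounds whose
comparison bit is `1`. -/
def roundSwap (N : ℕ) (B : Finset ℕ) (k : ℕ) : Equiv.Perm (Fin (N + 1)) :=
  if k ∈ B then Equiv.swap (Fin.ofNat (N + 1) (countBelow B k)) (Fin.ofNat (N + 1) k) else 1

/-- The first `k` rounds turn the row `A` into `A ∘ roundsPerm N B k`. -/
def roundsPerm (N : ℕ) (B : Finset ℕ) : ℕ → Equiv.Perm (Fin (N + 1))
  | 0 => 1
  | k + 1 => roundsPerm N B k * roundSwap N B k

/-- The whole protocol, with the final swap of the pivot, turns the row `A` into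
`A ∘ protocolPerm N B`. -/
def protocolPerm (N : ℕ) (B : Finset ℕ) : Equiv.Perm (Fin (N + 1)) :=
  roundsPerm N B N * Equiv.swap (Fin.ofNat (N + 1) (countBelow B N)) (Fin.ofNat (N + 1) N)

theorem roundsPerm_congr {N : ℕ} {B C : Finset ℕ} {k : ℕ} (h : ∀ x < k, x ∈ B ↔ x ∈ C) :
    roundsPerm N B k = roundsPerm N C k := by
  induction k with
  | zero => rfl
  | succ k ih =>
    rw [roundsPerm, roundsPerm, ih fun x hx => h x (by omega), roundSwap, roundSwap,
      countBelow_congr fun x (hx : x < k) => h x (by omega)]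
    simp only [h k k.lt_succ_self]

theorem val_ofNat {N a : ℕ} (h : a ≤ N) : (Fin.ofNat (N + 1) a).val = a := by
  rw [Fin.val_ofNat]
  exact Nat.mod_eq_of_lt (by omega)

theorem ofNat_eq_iff {N a : ℕ} (h : a ≤ N) (x : Fin (N + 1)) :
    x = Fin.ofNat (N + 1) a ↔ x.val = a := by
  rw [Fin.ext_iff, val_ofNat h]

/-- After `k` rounds the entries from the rounds in `B` come first, then the other ones, and the
positions from `k` on are untouched. -/
theorem roundsPerm_spec {N : ℕ} (B : Finset ℕ) {k : ℕ} (hk : k ≤ N) (x : Fin (N + 1)) :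
    (x.val < k → (roundsPerm N B k x).val < k ∧
      ((roundsPerm N B k x).val ∈ B ↔ x.val < countBelow B k)) ∧
    (k ≤ x.val → roundsPerm N B k x = x) := by
  induction k generalizing x with
  | zero => exact ⟨fun h => absurd h (Nat.not_lt_zero _), fun _ => rfl⟩
  | succ k ih =>
    have ih := ih (by omega)
    have ht := countBelow_le B k
    have hkv : (Fin.ofNat (N + 1) k).val = k := val_ofNat (by omega)
    have htv : (Fin.ofNat (N + 1) (countBelow B k)).val = countBelow B k := val_ofNat (by omega)
    rw [roundsPerm, Equiv.Perm.mul_apply, countBelow_succ, roundSwap]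
    by_cases hB : k ∈ B
    · rw [if_pos hB, if_pos hB]
      by_cases h1 : x.val = countBelow B k
      · rw [(ofNat_eq_iff (by omega) x).2 h1, Equiv.swap_apply_left, (ih _).2 hkv.ge, hkv, htv]
        exact ⟨fun _ => ⟨by omega, by simp [hB]⟩, fun h => by omega⟩
      by_cases h2 : x.val = k
      · rw [(ofNat_eq_iff (by omega) x).2 h2, Equiv.swap_apply_right, hkv]
        obtain ⟨h3, h4⟩ := (ih (Fin.ofNat (N + 1) (countBelow B k))).1 (by omega)
        rw [htv] at h4
        exact ⟨fun _ => ⟨by omega, h4.trans (by omega)⟩, fun h => by omega⟩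
      rw [Equiv.swap_apply_of_ne_of_ne (fun e => h1 ((ofNat_eq_iff (by omega) x).1 e))
        (fun e => h2 ((ofNat_eq_iff (by omega) x).1 e))]
      refine ⟨fun h => ?_, fun h => (ih x).2 (by omega)⟩
      obtain ⟨h3, h4⟩ := (ih x).1 (by omega)
      exact ⟨by omega, h4.trans (by omega)⟩
    · rw [if_neg hB, if_neg hB, Equiv.Perm.one_apply, add_zero]
      refine ⟨fun h => ?_, fun h => (ih x).2 (by omega)⟩
      by_cases h2 : x.val = k
      · rw [(ih x).2 h2.ge, h2]
        exact ⟨by omega, iff_of_false hB (by omega)⟩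
      · obtain ⟨h3, h4⟩ := (ih x).1 (by omega)
        exact ⟨by omega, h4⟩

theorem ofNat_self (N : ℕ) : Fin.ofNat (N + 1) N = Fin.last N :=
  Fin.ext (val_ofNat le_rfl)

/-- The pivot, the last entry, is moved to the position that the counter shows at the end. -/
theorem protocolPerm_last {N : ℕ} {B : Finset ℕ} (x : Fin (N + 1)) (hx : x.val = countBelow B N) :
    protocolPerm N B x = Fin.last N := by
  rw [protocolPerm, Equiv.Perm.mul_apply,
    (ofNat_eq_iff (countBelow_le B N) x).2 hx, Equiv.swap_apply_left, ofNat_self]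
  exact (roundsPerm_spec B le_rfl _).2 le_rfl

/-- The protocol moves the entries from the rounds in `B` to the left of the pivot, and no
others. -/
theorem protocolPerm_mem_iff {N : ℕ} {B : Finset ℕ} (hB : B ⊆ Finset.range N) (x : Fin (N + 1)) :
    (protocolPerm N B x).val ∈ B ↔ x.val < countBelow B N := by
  have hN : N ∉ B := fun h => by simpa using hB h
  by_cases h1 : x.val = countBelow B N
  · rw [protocolPerm_last x h1, Fin.val_last]
    exact iff_of_false hN (by omega)
  rw [protocolPerm, Equiv.Perm.mul_apply]
  have ht := countBelow_le B N
  by_cases h2 : x.val = N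
  · rw [(ofNat_eq_iff le_rfl x).2 h2, Equiv.swap_apply_right, val_ofNat le_rfl,
      ((roundsPerm_spec B le_rfl _).1 _).2, val_ofNat ht]
    · omega
    · rw [val_ofNat ht]; omega
  · rw [Equiv.swap_apply_of_ne_of_ne (fun e => h1 ((ofNat_eq_iff ht x).1 e))
        (fun e => h2 ((ofNat_eq_iff le_rfl x).1 e))]
    exact ((roundsPerm_spec B le_rfl x).1 (by omega)).2

/-! ### Shuffled rows and partitioned rows -/

/-- The rounds in which the comparison with the pivot, the last entry, gives the bit `1`. -/
def lessSet {w N : ℕ} (a : Fin (N + 1) → ZMod (2 ^ w)) : Finset ℕ :=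
  (Finset.range N).filter fun j => (a (Fin.ofNat (N + 1) j)).val < (a (Fin.last N)).val

theorem lessSet_subset {w N : ℕ} (a : Fin (N + 1) → ZMod (2 ^ w)) :
    lessSet a ⊆ Finset.range N := Finset.filter_subset _ _

/-- For the last entry itself both sides are false, so the bound `j < N` needs no mention. -/
theorem mem_lessSet {w N : ℕ} (a : Fin (N + 1) → ZMod (2 ^ w)) (j : Fin (N + 1)) :
    j.val ∈ lessSet a ↔ (a j).val < (a (Fin.last N)).val := by
  have hj : Fin.ofNat (N + 1) j.val = j := Fin.ext (val_ofNat (Nat.le_of_lt_succ j.2))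
  rw [lessSet, Finset.mem_filter, hj, Finset.mem_range, and_iff_right_iff_imp]
  intro h
  by_contra hN
  have : j = Fin.last N := Fin.ext (by have := j.2; simp only [Fin.val_last]; omega)
  rw [this] at h
  exact lt_irrefl _ h

/-- The position of the pivot is determined by the pivot entry. -/
theorem IsPartition.symm_val {w N : ℕ} {x : Fin (N + 1) → ZMod (2 ^ w)} {k : Fin (N + 1)}
    {ρ : Equiv.Perm (Fin (N + 1))} (h : IsPartition x k ρ) :
    (ρ.symm k).val = (Finset.univ.filter fun j => (x j).val < (x k).val).card := by
  rw [← Fin.card_Iio]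
  refine Finset.card_bij (fun j _ => ρ j) (fun j hj => ?_) (fun _ _ _ _ e => ρ.injective e)
    (fun j hj => ⟨ρ.symm j, ?_, by simp⟩)
  · simpa using (h j).2 (by simpa using hj)
  · simpa using (h (ρ.symm j)).1 (by simpa using hj)

/-- The protocol partitions a shuffled row `x ∘ σ` around its last entry. -/
theorem isPartition_of_shuffle {w N : ℕ} (x : Fin (N + 1) → ZMod (2 ^ w))
    (σ : Equiv.Perm (Fin (N + 1))) :
    IsPartition x (σ (Fin.last N)) (σ * protocolPerm N (lessSet (x ∘ σ))) ∧
      ((σ * protocolPerm N (lessSet (x ∘ σ))).symm (σ (Fin.last N))).val =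
        (lessSet (x ∘ σ)).card := by
  set B := lessSet (x ∘ σ) with hB
  have hBN : B ⊆ Finset.range N := lessSet_subset _
  have hq : ((σ * protocolPerm N B).symm (σ (Fin.last N))).val = countBelow B N := by
    have h := val_ofNat (countBelow_le B N)
    rw [← h]
    congr 1
    rw [Equiv.symm_apply_eq, Equiv.Perm.mul_apply, protocolPerm_last _ h]
  refine ⟨fun j => ?_, hq.trans (countBelow_eq_card hBN)⟩
  rw [Fin.lt_def, hq, ← protocolPerm_mem_iff hBN, hB, mem_lessSet]
  rfl

/-- Conversely, every partitioned rearrangement and every set of rounds of the right size come from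
a shuffle, which undoing the swaps recovers. -/
theorem shuffle_of_isPartition {w N : ℕ} {x : Fin (N + 1) → ZMod (2 ^ w)} {k : Fin (N + 1)}
    {ρ : Equiv.Perm (Fin (N + 1))} (h : IsPartition x k ρ) {B : Finset ℕ}
    (hB : B ∈ Finset.powersetCard (ρ.symm k).val (Finset.range N)) :
    (ρ * (protocolPerm N B)⁻¹) (Fin.last N) = k ∧
      lessSet (x ∘ (ρ * (protocolPerm N B)⁻¹)) = B := by
  obtain ⟨hBN, hc⟩ := Finset.mem_powersetCard.1 hB
  rw [← countBelow_eq_card hBN] at hc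
  have hlast : (ρ * (protocolPerm N B)⁻¹) (Fin.last N) = k := by
    rw [Equiv.Perm.mul_apply, ← protocolPerm_last _ hc.symm, Equiv.Perm.inv_def,
      Equiv.symm_apply_apply,
      Equiv.apply_symm_apply]
  refine ⟨hlast, ?_⟩
  ext j
  by_cases hj : j < N + 1
  · have := mem_lessSet (x ∘ (ρ * (protocolPerm N B)⁻¹)) ⟨j, hj⟩
    rw [this, Function.comp_apply, Function.comp_apply, hlast, Equiv.Perm.mul_apply, h,
      Fin.lt_def, ← hc, ← protocolPerm_mem_iff hBN, Equiv.Perm.inv_def,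
      Equiv.apply_symm_apply]
  · refine iff_of_false (fun h => ?_) (fun h => ?_)
    · have := Finset.mem_range.1 (lessSet_subset _ h); omega
    · have := Finset.mem_range.1 (hBN h); omega

/-- The families of bit sets, one for each row, of the sizes `q`. -/
def bitSets {m : ℕ} {n : Fin m → ℕ} (q : RowIndices n) : Finset (Fin m → Finset ℕ) :=
  Fintype.piFinset fun i => Finset.powersetCard (q i).val (Finset.range (n i))

theorem bitSets_nonempty {m : ℕ} {n : Fin m → ℕ} (q : RowIndices n) : (bitSets q).Nonempty :=
  Fintype.piFinset_nonempty.2 fun i => powersetCard_range_nonempty (Nat.le_of_lt_succ (q i).2)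

theorem mem_partitions {w m : ℕ} {n : Fin m → ℕ} {x : Rows w n} {k : RowIndices n}
    {ρ : RowPerms n} : ρ ∈ partitions x k ↔ ∀ i, IsPartition (x i) (k i) (ρ i) := by
  simp [partitions]

/-- The families of permutations that put the entries `k` at the ends of the rows. -/
def lastIs {m : ℕ} {n : Fin m → ℕ} (k : RowIndices n) : Finset (RowPerms n) :=
  Finset.univ.filter fun σ => ∀ i, σ i (Fin.last (n i)) = k i

theorem mem_lastIs {m : ℕ} {n : Fin m → ℕ} {k : RowIndices n} {σ : RowPerms n} :
    σ ∈ lastIs k ↔ ∀ i, σ i (Fin.last (n i)) = k i := by simp [lastIs]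

theorem lastIs_nonempty {m : ℕ} {n : Fin m → ℕ} (k : RowIndices n) : (lastIs k).Nonempty :=
  ⟨fun i => Equiv.swap (Fin.last _) (k i), by simp [mem_lastIs]⟩

theorem card_lastIs {m : ℕ} {n : Fin m → ℕ} (k : RowIndices n) :
    (lastIs k).card = (lastIs fun i => Fin.last (n i)).card := by
  refine Finset.card_nbij' (fun σ i => Equiv.swap (Fin.last _) (k i) * σ i)
    (fun σ i => Equiv.swap (Fin.last _) (k i) * σ i) ?_ ?_ ?_ ?_
  · intro σ hσ
    have hσ := mem_lastIs.1 hσ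
    exact mem_lastIs.2 fun i => by simp [hσ i]
  · intro σ hσ
    have hσ := mem_lastIs.1 hσ
    exact mem_lastIs.2 fun i => by simp [hσ i]
  · intro σ _
    funext i
    simp [← mul_assoc]
  · intro σ _
    funext i
    simp [← mul_assoc]

/-- A random partition of each row, taken back through the rounds of the protocol along random
comparison bits, is a random shuffle. -/
theorem uniform_shuffle {w m : ℕ} {n : Fin m → ℕ} (x : Rows w n) :
    ((PMF.uniformOfFintype (RowIndices n)).bind fun k =>
      (PMF.uniformOfFinset (partitions x k) (partitions_nonempty x k)).bind fun ρ =>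
        (PMF.uniformOfFinset (bitSets fun i => (ρ i).symm (k i)) (bitSets_nonempty _)).map
          fun B i => ρ i * (protocolPerm (n i) (B i))⁻¹) =
      PMF.uniformOfFintype (RowPerms n) := by
  have h : ∀ k : RowIndices n,
      ((PMF.uniformOfFinset (partitions x k) (partitions_nonempty x k)).bind fun ρ =>
        (PMF.uniformOfFinset (bitSets fun i => (ρ i).symm (k i)) (bitSets_nonempty _)).map
          fun B i => ρ i * (protocolPerm (n i) (B i))⁻¹) =
      (PMF.uniformOfFinset (lastIs k) (lastIs_nonempty k)).map id := by
    intro k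
    rw [PMF.map_id]
    refine uniform_bind_map_uniform (partitions_nonempty x k) (fun ρ => bitSets_nonempty _)
      (fun (ρ : RowPerms n) B i => ρ i * (protocolPerm (n i) (B i))⁻¹) (lastIs_nonempty k)
      (∏ i, Nat.choose (n i)
        (Finset.univ.filter fun j => (x i j).val < (x i (k i)).val).card)
      (fun ρ hρ => ?_) (fun ρ hρ B hB => ?_) (fun σ hσ => ?_)
    -- the number of bit sets depends on `k` only, as the pivot position of a partition does
    · rw [bitSets, Fintype.card_piFinset]
      refine Finset.prod_congr rfl fun i _ => ?_
      rw [(mem_partitions.1 hρ i).symm_val, Finset.card_powersetCard, Finset.card_range]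
    · exact mem_lastIs.2 fun i =>
        (shuffle_of_isPartition (mem_partitions.1 hρ i) (Fintype.mem_piFinset.1 hB i)).1
    · have hσ := mem_lastIs.1 hσ
      have h1 := fun i => isPartition_of_shuffle (x i) (σ i)
      simp only [hσ] at h1
      refine ⟨fun i => σ i * protocolPerm (n i) (lessSet (x i ∘ σ i)),
        mem_partitions.2 fun i => (h1 i).1, fun i => lessSet (x i ∘ σ i),
        Fintype.mem_piFinset.2 fun i => Finset.mem_powersetCard.2
          ⟨lessSet_subset _, (h1 i).2.symm⟩, ?_, ?_⟩
      · funext i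
        exact mul_inv_cancel_right _ _
      · rintro ρ hρ B hB rfl
        have h2 := fun i =>
          (shuffle_of_isPartition (mem_partitions.1 hρ i) (Fintype.mem_piFinset.1 hB i)).2
        refine ⟨funext fun i => ?_, funext fun i => (h2 i).symm⟩
        simp only [h2, inv_mul_cancel_right]
  simp only [h]
  refine uniform_bind_map_uniform Finset.univ_nonempty (fun k => lastIs_nonempty k)
    (fun k => id) Finset.univ_nonempty _ (fun k _ => card_lastIs k)
    (fun _ _ _ _ => Finset.mem_univ _) (fun σ _ => ⟨fun i => σ i (Fin.last _),
      Finset.mem_univ _, σ, mem_lastIs.2 fun i => rfl, rfl, ?_⟩)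
  rintro k - σ' hσ' rfl
  exact ⟨funext fun i => (mem_lastIs.1 hσ' i).symm, rfl⟩

/-! ### The output of one server -/

theorem freshSharing_map_share {w m : ℕ} {n : Fin m → ℕ} (x : Rows w n) (b : Bool) :
    (freshSharing x).map (fun s => s b) = PMF.uniformOfFintype (Rows w n) := by
  rw [freshSharing, PMF.map_comp]
  cases b
  · exact PMF.map_id _
  · exact uniformOfFintype_map_equiv (Equiv.subLeft x)

/-- For distinct entries the positions of the pivots are uniformly random, as the rank of an entry
in its row determines the entry. -/
theorem idealPartition_map_uniform {w m : ℕ} {n : Fin m → ℕ} (b : Bool) (D : Bool → Rows w n)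
    (hD : ∀ i, Function.Injective (plain D i)) :
    (idealPartition D).map (fun o => (o.q, o.share b)) =
      PMF.uniformOfFintype (RowIndices n × Rows w n) := by
  have hlt : ∀ (i : Fin m) (k : Fin (n i + 1)),
      (Finset.univ.filter fun j => (plain D i j).val < (plain D i k).val).card < n i + 1 := by
    intro i k
    obtain ⟨ρ, hρ⟩ := exists_isPartition (plain D i) k
    rw [← hρ.symm_val]
    exact (ρ.symm k).2
  let rank : RowIndices n → RowIndices n := fun k i => ⟨_, hlt i (k i)⟩
  have hrank : Function.Injective rank := by
    have hmono : ∀ (i : Fin m) (k k' : Fin (n i + 1)),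
        (plain D i k).val < (plain D i k').val →
        (Finset.univ.filter fun j => (plain D i j).val < (plain D i k).val).card <
          (Finset.univ.filter fun j => (plain D i j).val < (plain D i k').val).card := by
      intro i k k' hk
      refine Finset.card_lt_card (Finset.ssubset_iff_of_subset (fun j hj => ?_) |>.2 ⟨k, ?_, ?_⟩)
      · simp only [Finset.mem_filter, Finset.mem_univ, true_and] at hj ⊢; omega
      · simpa using hk
      · simp
    intro k k' h
    funext i
    have hi : (Finset.univ.filter fun j => (plain D i j).val < (plain D i (k i)).val).card =
        (Finset.univ.filter fun j => (plain D i j).val < (plain D i (k' i)).val).card :=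
      congrArg Fin.val (congrFun h i)
    rcases lt_trichotomy (plain D i (k i)).val (plain D i (k' i)).val with hl | he | hl
    · have := hmono i _ _ hl; omega
    · exact hD i (ZMod.val_injective _ he)
    · have := hmono i _ _ hl; omega
  have h1 : (idealPartition D).map (fun o => (o.q, o.share b)) =
      (PMF.uniformOfFintype (RowIndices n)).bind fun k =>
        (PMF.uniformOfFintype (Rows w n)).map fun s => (rank k, s) := by
    rw [idealPartition, PMF.map_bind]
    refine congrArg _ (funext fun k => ?_)
    rw [PMF.map_bind, ← PMF.bind_const (PMF.uniformOfFinset (partitions (plain D) k)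
      (partitions_nonempty (plain D) k)) ((PMF.uniformOfFintype (Rows w n)).map _)]
    refine bind_congr_support _ fun ρ hρ => ?_
    have hρ := mem_partitions.1 ((PMF.mem_support_uniformOfFinset_iff _ _).1 hρ)
    rw [← freshSharing_map_share (fun i j => plain D i (ρ i j)) b, PMF.map_comp, PMF.map_comp]
    refine congrArg (fun f => PMF.map f _) (funext fun s => ?_)
    exact Prod.ext (funext fun i => Fin.ext (hρ i).symm_val) rfl
  rw [h1]
  refine uniform_bind_map_uniform (t := fun _ => Finset.univ) Finset.univ_nonempty
    (fun _ => Finset.univ_nonempty)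
    (fun k s => (rank k, s)) Finset.univ_nonempty _ (fun _ _ => rfl)
    (fun _ _ _ _ => Finset.mem_univ _) (fun g _ => ?_)
  obtain ⟨k, hk⟩ := (Finite.injective_iff_surjective.1 hrank) g.1
  refine ⟨k, Finset.mem_univ _, g.2, Finset.mem_univ _, Prod.ext hk rfl, ?_⟩
  rintro k' - s - rfl
  exact ⟨(hrank hk).symm, rfl⟩

/-! ### The words of the comparison rounds -/

/-- The words that a server receives in round `j`, when the bits of row `i` are given by the set
`B i`: for each active row a uniformly random share, and its exclusive or with the bit. -/
noncomputable def roundLog {m : ℕ} (n : Fin m → ℕ) (B : Fin m → Finset ℕ) (j : ℕ) :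
    PMF (List ℕ) :=
  (PMF.uniformOfFintype (Fin m → Bool)).map fun r => (List.finRange m).flatMap fun i =>
    if j < n i then [(r i).toNat, (xor (r i) (decide (j ∈ B i))).toNat] else []

/-- The words that a server receives in the first `k` rounds. -/
noncomputable def roundsLog {m : ℕ} (n : Fin m → ℕ) (B : Fin m → Finset ℕ) : ℕ → PMF (List ℕ)
  | 0 => PMF.pure []
  | k + 1 => (roundsLog n B k).bind fun l => (roundLog n B k).map fun l' => l ++ l'

theorem uniform_prod_map_fst {α β : Type} [Fintype α] [Nonempty α] [Fintype β] [Nonempty β] :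
    (PMF.uniformOfFintype (α × β)).map Prod.fst = PMF.uniformOfFintype α := by
  have h : ((PMF.uniformOfFintype α).bind fun a => (PMF.uniformOfFintype β).map (Prod.mk a)) =
      PMF.uniformOfFintype (α × β) :=
    uniform_bind_map_uniform (t := fun _ => Finset.univ) Finset.univ_nonempty
      (fun _ => Finset.univ_nonempty) Prod.mk Finset.univ_nonempty _ (fun _ _ => rfl)
      (fun _ _ _ _ => Finset.mem_univ _) fun g _ =>
        ⟨g.1, Finset.mem_univ _, g.2, Finset.mem_univ _, rfl, by rintro a - b - rfl; simp⟩
  rw [← h, PMF.map_bind]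
  simp only [PMF.map_comp]
  exact (congrArg _ (funext fun a => PMF.map_const _ a)).trans (PMF.bind_pure _)

theorem uniform_map_restrict {ι : Type} [Fintype ι] [DecidableEq ι] (p : ι → Prop)
    [DecidablePred p] :
    (PMF.uniformOfFintype (ι → Bool)).map (fun f (a : {i // p i}) => f a) =
      PMF.uniformOfFintype ({i // p i} → Bool) := by
  rw [← uniform_prod_map_fst (α := {i // p i} → Bool) (β := {i // ¬ p i} → Bool),
    ← uniformOfFintype_map_equiv (Equiv.piEquivPiSubtypeProd p fun _ => Bool), PMF.map_comp]
  rfl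

/-- Whichever of the two servers `b` is, its own share of the bits is uniformly random, and the
share of the other server is the exclusive or of that and the bits. -/
theorem roundLog_eq {m : ℕ} (n : Fin m → ℕ) (B : Fin m → Finset ℕ) (j : ℕ) (b : Bool) :
    roundLog n B j = (PMF.uniformOfFintype (Active n j → Bool)).map fun r =>
      roundWords j (fun c a => if c then xor (r a) (decide (j ∈ B a.1)) else r a) b := by
  have h : roundLog n B j = (PMF.uniformOfFintype (Active n j → Bool)).map fun r =>
      roundWords j (fun c a => if c then xor (r a) (decide (j ∈ B a.1)) else r a) false := by
    rw [← uniform_map_restrict, PMF.map_comp, roundLog]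
    refine congrArg (fun f => PMF.map f _) (funext fun r => ?_)
    simp only [roundWords, Function.comp_apply]
    congr 1
  cases b
  · exact h
  · rw [h]
    let e : (Active n j → Bool) ≃ (Active n j → Bool) :=
      Function.Involutive.toPerm (fun r a => xor (r a) (decide (j ∈ B a.1)))
        fun r => by funext a; simp
    conv_lhs => rw [← uniformOfFintype_map_equiv e, PMF.map_comp]
    refine congrArg (fun f => PMF.map f _) (funext fun r => ?_)
    have he : ∀ a, e r a = xor (r a) (decide (j ∈ B a.1)) := fun a => rfl
    simp only [roundWords, Function.comp_apply, he]
    congr 1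
    funext i
    by_cases hi : j < n i <;> simp [hi]

/-! ### The real execution -/

/-- The rounds act on the rows through the set of the bits, and the words received are random
sharings of the bits. The entry compared in round `k` is still the original one, since earlier
swaps concern positions below `k` only. -/
theorem compareRounds_coupled {w m : ℕ} {n : Fin m → ℕ} (A : Bool → Rows w n) (b : Bool) (k : ℕ) :
    Coupled (roundsLog n (fun i => lessSet (plain A i)) k)
      (compareRounds (fun c i => A c i (Fin.last (n i))) k
        { share := A, less := fun _ => 0, log := fun _ => [] })
      fun l st =>
        (∀ c i, st.share c i =
          A c i ∘ roundsPerm (n i) (lessSet (plain A i)) (min k (n i))) ∧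
        (∀ i, st.less i = countBelow (lessSet (plain A i)) (min k (n i))) ∧ st.log b = l := by
  induction k with
  | zero => exact Coupled.pure ⟨fun c i => by simp [roundsPerm], fun i => by
      simp [countBelow_zero], rfl⟩
  | succ k ih =>
    rw [roundsLog, compareRounds]
    refine ih.bind fun l st ⟨h1, h2, h3⟩ => ?_
    have hbit : ∀ a : Active n k,
        decide ((st.share false a.1 (Fin.ofNat (n a.1 + 1) k) +
            st.share true a.1 (Fin.ofNat (n a.1 + 1) k)).val <
          (A false a.1 (Fin.last (n a.1)) + A true a.1 (Fin.last (n a.1))).val) =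
        decide (k ∈ lessSet (plain A a.1)) := by
      intro a
      have hk : roundsPerm (n a.1) (lessSet (plain A a.1)) (min k (n a.1))
          (Fin.ofNat (n a.1 + 1) k) = Fin.ofNat (n a.1 + 1) k := by
        rw [min_eq_left a.2.le]
        exact (roundsPerm_spec _ a.2.le _).2 (val_ofNat a.2.le).ge
      have := mem_lessSet (plain A a.1) (Fin.ofNat (n a.1 + 1) k)
      rw [val_ofNat a.2.le] at this
      rw [h1, h1, Function.comp_apply, Function.comp_apply, hk]
      exact decide_eq_decide.2 this.symm
    rw [roundLog_eq n _ k b, compareRound, packedCompare]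
    refine Coupled.map_left (Coupled.map_left (Coupled.map_right (Coupled.map_right
      ((Coupled.refl _).mono ?_))))
    rintro r _ rfl
    simp only [hbit]
    refine ⟨fun c i => ?_, fun i => ?_, ?_⟩
    · by_cases hi : k < n i
      · have hm : min (k + 1) (n i) = k + 1 := by omega
        have hm' : min k (n i) = k := by omega
        by_cases hB : k ∈ lessSet (plain A i)
        · simp only [afterReveal, hi, hB, hm, roundsPerm, roundSwap]
          funext x
          simp [swapEntries, h1, h2, hm']
        · simp only [afterReveal, hi, hB, hm, roundsPerm, roundSwap]
          simp [h1, hm']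
      · have hm : min (k + 1) (n i) = min k (n i) := by omega
        simp [afterReveal, hi, h1, hm]
    · by_cases hi : k < n i
      · have hm' : min k (n i) = k := by omega
        by_cases hB : k ∈ lessSet (plain A i)
        · simp [afterReveal, hi, hB, countBelow_succ, h2, hm']
        · simp [afterReveal, hi, hB, countBelow_succ, h2, hm']
      · have hm : min (k + 1) (n i) = min k (n i) := by omega
        simp [afterReveal, hi, h2, hm]
    · simp [afterReveal, h3]

/-- The view of server `b` and the output of the partition protocol on the shared rows `A`. -/
theorem mulRowPartition_view {w m : ℕ} {n : Fin m → ℕ} (A : Bool → Rows w n) (b : Bool) :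
    (mulRowPartition A).map (fun e => (rowWords (A b) ++ e.2 b, e.1)) =
      (roundsLog n (fun i => lessSet (plain A i)) (Finset.univ.sup n)).map fun l =>
        (rowWords (A b) ++ l,
          { q := fun i => Fin.ofNat (n i + 1) (countBelow (lessSet (plain A i)) (n i))
            share := fun c i => A c i ∘ protocolPerm (n i) (lessSet (plain A i)) }) := by
  rw [mulRowPartition, PMF.map_comp]
  symm
  refine (compareRounds_coupled A b _).map_eq _ _ fun l st ⟨h1, h2, h3⟩ => ?_
  have hm : ∀ i, min (Finset.univ.sup n) (n i) = n i := fun i =>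
    min_eq_right (Finset.le_sup (Finset.mem_univ i))
  simp only [hm] at h1 h2
  simp only [Function.comp_apply, h3, h2]
  congr 2
  funext c i
  rw [h1]
  rfl

/-- Rearranging the rows commutes with sharing them. -/
theorem freshSharing_comp {w m : ℕ} {n : Fin m → ℕ} (x : Rows w n) (τ : RowPerms n) :
    freshSharing (fun i => x i ∘ τ i) = (freshSharing x).map fun s c i => s c i ∘ τ i := by
  let e : Rows w n ≃ Rows w n := Equiv.piCongrRight fun i =>
    (τ i).symm.arrowCongr (Equiv.refl (ZMod (2 ^ w)))
  rw [freshSharing, freshSharing]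
  conv_lhs => rw [← uniformOfFintype_map_equiv e]
  rw [PMF.map_comp, PMF.map_comp]
  congr 1
  funext r c i
  cases c <;> rfl

theorem plain_of_mem_freshSharing {w m : ℕ} {n : Fin m → ℕ} {x : Rows w n} {A : Bool → Rows w n}
    (h : A ∈ (freshSharing x).support) : plain A = x := by
  obtain ⟨r, -, rfl⟩ := (PMF.mem_support_map_iff _ _ _).1 h
  funext i k
  simp [plain]

/-- The real execution, from a uniformly random joint shuffle of the rows. -/
theorem realWorld_eq_shuffle {w m : ℕ} {n : Fin m → ℕ} (b : Bool) (D : Bool → Rows w n)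
    (πb : RowPerms n) :
    realWorld b D πb = (PMF.uniformOfFintype (RowPerms n)).bind fun σ =>
      (freshSharing fun i => plain D i ∘ σ i).bind fun A =>
        (roundsLog n (fun i => lessSet (plain D i ∘ σ i)) (Finset.univ.sup n)).map fun l =>
        (rowWords (A b) ++ l,
          { q := fun i => Fin.ofNat (n i + 1) (countBelow (lessSet (plain D i ∘ σ i)) (n i))
            share := fun c i =>
              A c i ∘ protocolPerm (n i) (lessSet (plain D i ∘ σ i)) }) := by
  -- the composite of the two permutations is uniform since that of the honest server is
  let e : RowPerms n ≃ RowPerms n := Equiv.piCongrRight fun i =>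
    if b then Equiv.mulRight (πb i) else Equiv.mulLeft (πb i)
  rw [realWorld]
  nth_rw 2 [← uniformOfFintype_map_equiv e]
  rw [PMF.bind_map]
  refine congrArg _ (funext fun πh => ?_)
  have he : matrixSharedShuffle D (fun c => if c = b then πb else πh) =
      freshSharing fun i => plain D i ∘ e πh i := by
    rw [matrixSharedShuffle]
    congr 1
    funext i k
    cases b <;> simp [e]
  rw [he, Function.comp_apply]
  refine bind_congr_support _ fun A hA => ?_
  rw [mulRowPartition_view, plain_of_mem_freshSharing hA]

/-- The real execution, from the output of the ideal functionality: the comparison bits are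
uniformly random subject to the positions of the pivots, and the shuffled rows are found by
undoing the swaps. -/
theorem realWorld_eq {w m : ℕ} {n : Fin m → ℕ} (b : Bool) (D : Bool → Rows w n)
    (πb : RowPerms n) :
    realWorld b D πb = (idealPartition D).bind fun o =>
      ((PMF.uniformOfFinset (bitSets o.q) (bitSets_nonempty _)).bind fun B =>
        (roundsLog n B (Finset.univ.sup n)).map fun l =>
          rowWords (fun i => o.share b i ∘ ⇑(protocolPerm (n i) (B i))⁻¹) ++ l).map
        fun v => (v, o) := by
  rw [realWorld_eq_shuffle, ← uniform_shuffle (plain D), idealPartition, PMF.bind_bind,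
    PMF.bind_bind]
  refine congrArg _ (funext fun k => ?_)
  rw [PMF.bind_bind, PMF.bind_bind]
  refine bind_congr_support _ fun ρ hρ => ?_
  have hρ := mem_partitions.1 ((PMF.mem_support_uniformOfFinset_iff _ _).1 hρ)
  rw [PMF.bind_map, PMF.bind_map]
  simp only [Function.comp_def, PMF.map_bind]
  refine Eq.trans ?_ (PMF.bind_comm (PMF.uniformOfFinset (bitSets fun i => (ρ i).symm (k i))
    (bitSets_nonempty _)) (freshSharing _) _)
  refine bind_congr_support _ fun B hB => ?_
  have hB := Fintype.mem_piFinset.1 ((PMF.mem_support_uniformOfFinset_iff _ _).1 hB)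
  have hl := fun i => (shuffle_of_isPartition (hρ i) (hB i)).2
  have hq : ∀ i, Fin.ofNat (n i + 1) (countBelow (B i) (n i)) = (ρ i).symm (k i) := by
    intro i
    obtain ⟨h1, h2⟩ := Finset.mem_powersetCard.1 (hB i)
    refine ((ofNat_eq_iff (countBelow_le _ _) _).2 ?_).symm
    rw [countBelow_eq_card h1, h2]
  have hf := freshSharing_comp (fun i j => plain D i (ρ i j))
    fun i => (protocolPerm (n i) (B i))⁻¹
  have hf' : (freshSharing fun i j => plain D i ((ρ i * (protocolPerm (n i) (B i))⁻¹) j)) =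
      _ := hf
  rw [hf', PMF.bind_map]
  refine congrArg _ (funext fun s => ?_)
  have hl' : ∀ i, lessSet (fun j => plain D i ((ρ i * (protocolPerm (n i) (B i))⁻¹) j)) = B i := hl
  simp only [hl', hq, Function.comp_def, PMF.map_comp]
  refine congrArg (fun f => PMF.map f _) (funext fun l => ?_)
  simp [Equiv.Perm.inv_def]

/-! ### The program of the simulator -/

namespace Simulator

local infixr:60 " ;; " => Prog.seq

/-- Register 4 becomes the maximum of its value and register 8, and the pointer in register 5 moves
on. -/
def sizesTail : Prog := .ifLe 8 4 (.const 17 0) (.add 4 8 0) ;; .add 5 5 1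

/-- Adds the length of a row to register 3. -/
def sizesBody : Prog := (.read 8 5 ;; .add 3 3 8 ;; .add 3 3 1) ;; sizesTail

/-- Copies one word of the final share to the memory. -/
def copyBody : Prog := .read 13 11 ;; .store 10 13 ;; .add 10 10 1 ;; .add 11 11 1

/-- Exchanges the memory cells with the addresses in the registers 11 and 12. -/
def swapMem : Prog := .load 13 11 ;; .load 14 12 ;; .store 11 14 ;; .store 12 13

/-- The bit of round `j` is `1` if the random number in register 16 is below the number of ones
left. In this case the swap of the round is undone. The bit is stored at the place of the entry `j`,
behind all rows. -/
def undoTail : Prog :=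
  .ifLe 9 16 (.const 17 0)
    (.sub 9 9 1 ;; .add 11 7 9 ;; .add 12 7 10 ;; swapMem ;; .const 17 1) ;;
  .add 11 3 7 ;; .add 11 11 10 ;; .store 11 17

/-- Samples the bit of the next lower round of a row, and undoes the round. -/
def undoBody : Prog := .sub 10 10 1 ;; .rand 16 10 ;; undoTail

/-- Reads the length and the pivot position of a row, and undoes the final swap of the pivot. -/
def rowHead : Prog :=
  .read 8 5 ;; .read 9 15 ;; .add 11 7 9 ;; .add 12 7 8 ;; swapMem ;; .add 10 8 0

/-- Moves the pointers on to the next row. -/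
def rowTail : Prog := .add 5 5 1 ;; .add 15 15 1 ;; .add 7 7 8 ;; .add 7 7 1

/-- Samples the comparison bits of a row, and undoes the protocol on it. -/
def rowBody : Prog := rowHead ;; .loop 8 undoBody ;; rowTail

/-- Puts out one word of the memory. -/
def emitBody : Prog := .load 13 10 ;; .emit 13 ;; .add 10 10 1

/-- In an active row, puts out the coin in register 16 and its exclusive or with the comparison bit.
Then the pointers move on to the next row. -/
def wordsTail : Prog :=
  .ifLe 9 8
    (.add 11 7 10 ;; .load 17 11 ;; .emit 16 ;;
      .sub 11 16 17 ;; .sub 12 17 16 ;; .add 16 11 12 ;; .emit 16)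
    (.const 17 0) ;;
  .add 5 5 1 ;; .add 7 7 8 ;; .add 7 7 1

/-- Puts out the words of one row in a round; row `i` is active in round `j` if `j + 1 ≤ n i`. -/
def wordsBody : Prog := (.read 8 5 ;; .add 9 10 1) ;; .rand 16 1 ;; wordsTail

/-- Puts out the words of one round. -/
def roundBody : Prog := (.const 5 2 ;; .add 7 3 0) ;; .loop 2 wordsBody ;; .add 10 10 1

/-- Reads the sizes, and copies the final share to the memory. -/
def prepare : Prog :=
  (.const 1 1 ;; .read 2 1 ;; .const 5 2) ;; .loop 2 sizesBody ;;
  (.add 15 5 3 ;; .add 15 15 3 ;; .add 11 15 2) ;; .loop 3 copyBody ;; .const 5 2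

/-- Puts out the recovered share of the shuffled rows. -/
def finish : Prog := .const 10 0 ;; .loop 3 emitBody ;; .const 10 0

/-- The simulator. The registers 0 and 1 hold these constants, 2 the number `m` of rows, 3 the
total length `T`, 4 the maximum of the `n i`, which is the number of rounds. The registers 5 and 15
point to the size and the pivot position of the current row in the input, 7 to its start in the
memory, 8 holds its `n i`, 9 the number of ones that are left, and 10 is a loop counter. The memory
cells below `T` hold the rows, and the bit of an entry is stored `T` cells above the entry. -/
def program : Prog := prepare ;; .loop 2 rowBody ;; finish ;; .loop 4 roundBody

variable {input : List ℕ}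

theorem undoTail_zero (s : Mach) (h : s.reg 9 ≤ s.reg 16) :
    ∃ s', undoTail.exec input s = PMF.pure s' ∧ s'.reg 9 = s.reg 9 ∧ s'.reg 10 = s.reg 10 ∧
      (∀ r, r < 9 ∨ r = 15 → s'.reg r = s.reg r) ∧ s'.out = s.out ∧
      s'.steps ≤ s.steps + 12 ∧
      s'.mem = Function.update s.mem (s.reg 3 + s.reg 7 + s.reg 10) 0 := by
  simp only [undoTail, Prog.exec, PMF.pure_bind, if_pos h]
  refine ⟨_, rfl, ?_, ?_, ?_, ?_, ?_, ?_⟩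
  · simp [Mach.setReg]
  · simp [Mach.setReg]
  · intro r hr
    have h1 : r ≠ 11 := by omega
    have h2 : r ≠ 17 := by omega
    simp [Mach.setReg, h1, h2]
  · simp [Mach.setReg]
  · simp [Mach.setReg]
  · simp [Mach.setReg]

theorem undoTail_one (s : Mach) (h : ¬ s.reg 9 ≤ s.reg 16) (h1 : s.reg 1 = 1) :
    ∃ s', undoTail.exec input s = PMF.pure s' ∧ s'.reg 9 = s.reg 9 - 1 ∧ s'.reg 10 = s.reg 10 ∧
      (∀ r, r < 9 ∨ r = 15 → s'.reg r = s.reg r) ∧ s'.out = s.out ∧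
      s'.steps ≤ s.steps + 12 ∧
      s'.mem = Function.update (Function.update (Function.update s.mem
        (s.reg 7 + (s.reg 9 - 1)) (s.mem (s.reg 7 + s.reg 10)))
        (s.reg 7 + s.reg 10) (s.mem (s.reg 7 + (s.reg 9 - 1))))
        (s.reg 3 + s.reg 7 + s.reg 10) 1 := by
  simp only [undoTail, swapMem, Prog.exec, PMF.pure_bind, if_neg h]
  refine ⟨_, rfl, ?_, ?_, ?_, ?_, ?_, ?_⟩
  · simp [Mach.setReg, h1]
  · simp [Mach.setReg]
  · intro r hr
    have h9 : r ≠ 9 := by omega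
    have h11 : r ≠ 11 := by omega
    have h12 : r ≠ 12 := by omega
    have h13 : r ≠ 13 := by omega
    have h14 : r ≠ 14 := by omega
    have h17 : r ≠ 17 := by omega
    simp [Mach.setReg, h9, h11, h12, h13, h14, h17]
  · simp [Mach.setReg]
  · simp [Mach.setReg]
  · simp [Mach.setReg, h1]

theorem rowHead_exec (s : Mach) (h0 : s.reg 0 = 0) :
    ∃ s', rowHead.exec input s = PMF.pure s' ∧ s'.reg 8 = input.getD (s.reg 5) 0 ∧
      s'.reg 9 = input.getD (s.reg 15) 0 ∧ s'.reg 10 = input.getD (s.reg 5) 0 ∧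
      (∀ r, r < 8 ∨ r = 15 → s'.reg r = s.reg r) ∧ s'.out = s.out ∧
      s'.steps = s.steps + 9 ∧
      s'.mem = Function.update (Function.update s.mem
        (s.reg 7 + input.getD (s.reg 15) 0) (s.mem (s.reg 7 + input.getD (s.reg 5) 0)))
        (s.reg 7 + input.getD (s.reg 5) 0) (s.mem (s.reg 7 + input.getD (s.reg 15) 0)) := by
  simp only [rowHead, swapMem, Prog.exec, PMF.pure_bind]
  refine ⟨_, rfl, ?_, ?_, ?_, ?_, ?_, ?_, ?_⟩
  · simp [Mach.setReg]
  · simp [Mach.setReg]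
  · simp [Mach.setReg, h0]
  · intro r hr
    have h8 : r ≠ 8 := by omega
    have h9 : r ≠ 9 := by omega
    have h10 : r ≠ 10 := by omega
    have h11 : r ≠ 11 := by omega
    have h12 : r ≠ 12 := by omega
    have h13 : r ≠ 13 := by omega
    have h14 : r ≠ 14 := by omega
    simp [Mach.setReg, h8, h9, h10, h11, h12, h13, h14]
  · simp [Mach.setReg]
  · simp [Mach.setReg]
  · simp [Mach.setReg]

theorem sizesTail_exec (s : Mach) (h0 : s.reg 0 = 0) (h1 : s.reg 1 = 1) :
    ∃ s', sizesTail.exec input s = PMF.pure s' ∧ s'.reg 4 = max (s.reg 4) (s.reg 8) ∧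
      s'.reg 5 = s.reg 5 + 1 ∧ (∀ r, r ≠ 4 ∧ r ≠ 5 ∧ r ≠ 17 → s'.reg r = s.reg r) ∧
      s'.mem = s.mem ∧ s'.out = s.out ∧ s'.steps = s.steps + 3 := by
  by_cases h : s.reg 8 ≤ s.reg 4
  · simp only [sizesTail, Prog.exec, PMF.pure_bind, if_pos h]
    refine ⟨_, rfl, ?_, ?_, fun r ⟨h4, h5, h17⟩ => ?_, ?_, ?_, ?_⟩
    · simp [Mach.setReg, h]
    · simp [Mach.setReg, h1]
    · simp [Mach.setReg, h5, h17]
    · simp [Mach.setReg]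
    · simp [Mach.setReg]
    · simp [Mach.setReg]
  · simp only [sizesTail, Prog.exec, PMF.pure_bind, if_neg h]
    refine ⟨_, rfl, ?_, ?_, fun r ⟨h4, h5, h17⟩ => ?_, ?_, ?_, ?_⟩
    · simp [Mach.setReg, h0, (not_le.1 h).le]
    · simp [Mach.setReg, h1]
    · simp [Mach.setReg, h4, h5]
    · simp [Mach.setReg]
    · simp [Mach.setReg]
    · simp [Mach.setReg]

/-- The exclusive or of the bits `r` and `c` is computed as `(r - c) + (c - r)` with truncated
subtraction. -/
theorem wordsTail_exec (s : Mach) (h1 : s.reg 1 = 1) (rb bit : Bool)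
    (h16 : s.reg 16 = rb.toNat)
    (hm : s.reg 9 ≤ s.reg 8 → s.mem (s.reg 7 + s.reg 10) = bit.toNat) :
    ∃ s', wordsTail.exec input s = PMF.pure s' ∧ s'.reg 5 = s.reg 5 + 1 ∧
      s'.reg 7 = s.reg 7 + (s.reg 8 + 1) ∧ s'.reg 10 = s.reg 10 ∧
      (∀ r, r < 5 → s'.reg r = s.reg r) ∧ s'.mem = s.mem ∧
      s'.out = s.out ++ (if s.reg 9 ≤ s.reg 8 then [rb.toNat, (xor rb bit).toNat] else []) ∧
      s'.steps ≤ s.steps + 11 := by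
  by_cases h : s.reg 9 ≤ s.reg 8
  · have hx : rb.toNat - bit.toNat + (bit.toNat - rb.toNat) = (xor rb bit).toNat := by
      cases rb <;> cases bit <;> rfl
    simp only [wordsTail, Prog.exec, PMF.pure_bind, if_pos h]
    refine ⟨_, rfl, ?_, ?_, ?_, fun r hr => ?_, ?_, ?_, ?_⟩
    · simp [Mach.setReg, h1]
    · simp [Mach.setReg, h1, add_assoc]
    · simp [Mach.setReg]
    · have h5 : r ≠ 5 := by omega
      have h7 : r ≠ 7 := by omega
      have h11 : r ≠ 11 := by omega
      have h12 : r ≠ 12 := by omega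
      have h16 : r ≠ 16 := by omega
      have h17 : r ≠ 17 := by omega
      simp [Mach.setReg, h5, h7, h11, h12, h16, h17]
    · simp [Mach.setReg]
    · simp [Mach.setReg, h16, hm h, hx]
    · simp [Mach.setReg]
  · simp only [wordsTail, Prog.exec, PMF.pure_bind, if_neg h]
    refine ⟨_, rfl, ?_, ?_, ?_, fun r hr => ?_, ?_, ?_, ?_⟩
    · simp [Mach.setReg, h1]
    · simp [Mach.setReg, h1, add_assoc]
    · simp [Mach.setReg]
    · have h5 : r ≠ 5 := by omega
      have h7 : r ≠ 7 := by omega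
      have h17 : r ≠ 17 := by omega
      simp [Mach.setReg, h5, h7, h17]
    · simp [Mach.setReg]
    · simp [Mach.setReg]
    · simp [Mach.setReg]

/-! ### Correctness of the simulator -/

section Coupling

variable {α : Type} {μ : PMF α} {R S : α → Mach → Prop} {p q : Prog}

theorem coupled_seq_of_pure {s s' : Mach} (hp : p.exec input s = PMF.pure s')
    (h : Coupled μ (q.exec input s') R) : Coupled μ ((p ;; q).exec input s) R := by
  rw [Prog.exec, hp, PMF.pure_bind]
  exact h

theorem coupled_seq_pure {s : Mach} (h : Coupled μ (p.exec input s) R)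
    (hq : ∀ a s', R a s' → ∃ s'', q.exec input s' = PMF.pure s'' ∧ S a s'') :
    Coupled μ ((p ;; q).exec input s) S := by
  rw [Prog.exec, ← PMF.bind_pure μ]
  refine h.bind fun a s' ha => ?_
  obtain ⟨s'', e, hS⟩ := hq a s' ha
  rw [e]
  exact Coupled.pure hS

theorem coupled_rand {x y k : ℕ} {s : Mach} (h : s.reg y = k) :
    Coupled (PMF.uniformOfFintype (Fin (k + 1))) ((Prog.rand x y).exec input s)
      fun v s' => s' = s.setReg x v.val := by
  subst h
  rw [Prog.exec]
  exact Coupled.map_right ((Coupled.refl _).mono fun v v' e => by rw [e])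

/-- With bound `1`, the instruction `rand` tosses a fair coin. -/
theorem coupled_rand_bool {x y : ℕ} {s : Mach} (h : s.reg y = 1) :
    Coupled (PMF.uniformOfFintype Bool) ((Prog.rand x y).exec input s)
      fun r s' => s' = s.setReg x r.toNat := by
  rw [← uniformOfFintype_map_equiv finTwoEquiv]
  refine Coupled.map_left ((coupled_rand h).mono ?_)
  rintro v s' rfl
  congr 1
  fin_cases v <;> rfl

end Coupling

/-- Exchanging two memory cells of a row segment permutes the segment by a transposition. -/
theorem update_swap {N a b : ℕ} (mem : ℕ → ℕ) (off : ℕ) (ha : a ≤ N) (hb : b ≤ N)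
    (x : Fin (N + 1)) :
    Function.update (Function.update mem (off + a) (mem (off + b))) (off + b) (mem (off + a))
        (off + x.val) =
      mem (off + (Equiv.swap (Fin.ofNat (N + 1) a) (Fin.ofNat (N + 1) b) x).val) := by
  by_cases h1 : x.val = b
  · rw [(ofNat_eq_iff hb x).2 h1, Equiv.swap_apply_right, val_ofNat hb, val_ofNat ha,
      Function.update_self]
  have h1' : off + x.val ≠ off + b := by omega
  rw [Function.update_of_ne h1']
  by_cases h2 : x.val = a
  · rw [(ofNat_eq_iff ha x).2 h2, Equiv.swap_apply_left, val_ofNat hb, val_ofNat ha,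
      Function.update_self]
  have h2' : off + x.val ≠ off + a := by omega
  rw [Function.update_of_ne h2', Equiv.swap_apply_of_ne_of_ne
    (fun e => h2 ((ofNat_eq_iff ha x).1 e)) (fun e => h1 ((ofNat_eq_iff hb x).1 e))]

/-- The inner loop samples the comparison bits of a row from the last round to the first, undoes
the swaps of the rounds and stores the bits. -/
theorem undo_coupled {N k r : ℕ} {s : Mach} (hk : k ≤ N) (hr : r ≤ k) (h1 : s.reg 1 = 1)
    (h9 : s.reg 9 = r) (h10 : s.reg 10 = k) (hT : s.reg 7 + N + 1 ≤ s.reg 3) :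
    Coupled (subsetPMF k r) (repeatStep (undoBody.exec input) k s) fun B s' =>
      B ⊆ Finset.range k ∧ B.card = r ∧
      (∀ x, x < 9 ∨ x = 15 → s'.reg x = s.reg x) ∧ s'.out = s.out ∧
      s'.steps ≤ s.steps + 14 * k ∧
      (∀ x : Fin (N + 1), s'.mem (s.reg 7 + x.val) =
        s.mem (s.reg 7 + ((roundsPerm N B k)⁻¹ x).val)) ∧
      (∀ j < k, s'.mem (s.reg 3 + s.reg 7 + j) = if j ∈ B then 1 else 0) ∧
      (∀ a, ¬ (s.reg 7 ≤ a ∧ a ≤ s.reg 7 + N) →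
        ¬ (s.reg 3 + s.reg 7 ≤ a ∧ a < s.reg 3 + s.reg 7 + k) → s'.mem a = s.mem a) := by
  induction k generalizing r s with
  | zero =>
    obtain rfl : r = 0 := by omega
    exact Coupled.pure ⟨by simp, rfl, fun _ _ => rfl, rfl, by simp, fun x => rfl,
      fun j hj => absurd hj (Nat.not_lt_zero _), fun _ _ _ => rfl⟩
  | succ k ih =>
    rw [subsetPMF, repeatStep, undoBody, Prog.exec, Prog.exec, PMF.pure_bind, Prog.exec,
      PMF.bind_bind]
    refine (coupled_rand (k := k) (by simp [Mach.setReg, h1, h10])).bind ?_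
    rintro v _ rfl
    set s1 := (s.setReg 10 (s.reg 10 - s.reg 1)).setReg 16 v.val with hs1
    have e16 : s1.reg 16 = v := by simp [hs1, Mach.setReg]
    have e10 : s1.reg 10 = k := by simp [hs1, Mach.setReg, h1, h10]
    have e9 : s1.reg 9 = r := by simp [hs1, Mach.setReg, h9]
    have er : ∀ x, x < 9 ∨ x = 15 → s1.reg x = s.reg x := by
      intro x hx
      have h16 : x ≠ 16 := by omega
      have h10 : x ≠ 10 := by omega
      simp [hs1, Mach.setReg, h16, h10]
    have em : s1.mem = s.mem := by simp [hs1, Mach.setReg]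
    have eo : s1.out = s.out := by simp [hs1, Mach.setReg]
    have es : s1.steps = s.steps + 2 := by simp [hs1, Mach.setReg]
    have e1 : s1.reg 1 = 1 := by rw [er 1 (by omega), h1]
    have e3 := er 3 (by omega)
    have e7 := er 7 (by omega)
    by_cases hv : v.val < r
    · rw [if_pos hv]
      obtain ⟨s2, hs2, f9, f10, fr, fo, fs, fm⟩ :=
        undoTail_one (input := input) s1 (by omega) e1
      have f3 := (fr 3 (by omega)).trans e3
      have f7 := (fr 7 (by omega)).trans e7
      rw [e3, e7, e9, e10, em] at fm
      rw [hs2, PMF.pure_bind]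
      refine Coupled.map_left ((ih (s := s2) (r := r - 1) (by omega) (by omega)
        (by rw [fr 1 (by omega), e1]) (by omega) (by omega) (by omega)).mono ?_)
      rintro B s' ⟨g1, g2, gr, go, gs, gm, gb, gf⟩
      rw [f7] at gm
      rw [f3, f7] at gb gf
      have hkB : k ∉ B := fun h => by simpa using g1 h
      -- the counter of the protocol before round `k` equals the number of ones left below
      have hcount : countBelow (insert k B) k = r - 1 := by
        rw [← g2, ← countBelow_eq_card g1]
        refine countBelow_congr fun x hx => ?_
        rw [Finset.mem_insert]
        exact ⟨fun h => h.resolve_left (by omega), .inr⟩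
      have hperm : roundsPerm N (insert k B) k = roundsPerm N B k := by
        refine roundsPerm_congr fun x hx => ?_
        rw [Finset.mem_insert]
        exact ⟨fun h => h.resolve_left (by omega), .inr⟩
      refine ⟨?_, ?_, fun x hx => ?_, ?_, ?_, fun x => ?_, fun j hj => ?_, fun a ha1 ha2 => ?_⟩
      · rw [Finset.range_add_one]
        exact Finset.insert_subset_insert _ g1
      · rw [Finset.card_insert_of_notMem hkB]; omega
      · rw [gr x hx, fr x hx, er x hx]
      · rw [go, fo, eo]
      · omega
      · rw [gm, fm, Function.update_of_ne (by
            have := ((roundsPerm N B k)⁻¹ x).2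
            omega),
          update_swap _ _ (by omega) (by omega), roundsPerm, roundSwap,
          if_pos (Finset.mem_insert_self _ _), hcount, hperm, mul_inv_rev, Equiv.swap_inv]
        rfl
      · by_cases hjk : j = k
        · subst hjk
          rw [gf _ (by omega) (by omega), fm, Function.update_self,
            if_pos (Finset.mem_insert_self _ _)]
        · rw [gb j (by omega)]
          simp [hjk]
      · rw [gf a ha1 (by omega), fm, Function.update_of_ne (by omega),
          Function.update_of_ne (by omega), Function.update_of_ne (by omega)]
    · rw [if_neg hv]
      obtain ⟨s2, hs2, f9, f10, fr, fo, fs, fm⟩ :=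
        undoTail_zero (input := input) s1 (by omega)
      have f3 := (fr 3 (by omega)).trans e3
      have f7 := (fr 7 (by omega)).trans e7
      have hrk : r ≤ k := by have := v.2; omega
      rw [e3, e7, e10, em] at fm
      rw [hs2, PMF.pure_bind]
      refine ((ih (s := s2) (r := r) (by omega) hrk
        (by rw [fr 1 (by omega), e1]) (by omega) (by omega) (by omega)).mono ?_)
      rintro B s' ⟨g1, g2, gr, go, gs, gm, gb, gf⟩
      rw [f7] at gm
      rw [f3, f7] at gb gf
      have hkB : k ∉ B := fun h => by simpa using g1 h
      refine ⟨?_, g2, fun x hx => ?_, ?_, ?_, fun x => ?_, fun j hj => ?_, fun a ha1 ha2 => ?_⟩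
      · exact g1.trans (Finset.range_subset_range.2 k.le_succ)
      · rw [gr x hx, fr x hx, er x hx]
      · rw [go, fo, eo]
      · omega
      · rw [gm, fm, Function.update_of_ne (by
            have := ((roundsPerm N B k)⁻¹ x).2
            omega), roundsPerm, roundSwap, if_neg hkB, mul_one]
      · by_cases hjk : j = k
        · subst hjk
          rw [gf _ (by omega) (by omega), fm, Function.update_self, if_neg hkB]
        · rw [gb j (by omega)]
      · rw [gf a ha1 (by omega), fm, Function.update_of_ne (by omega)]

/-! ### The input of the simulator -/

/-- The position of row `i` in the concatenation of the rows. -/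
def offset (nn : ℕ → ℕ) (i : ℕ) : ℕ := ∑ i' ∈ Finset.range i, (nn i' + 1)

theorem offset_succ (nn : ℕ → ℕ) (i : ℕ) : offset nn (i + 1) = offset nn i + (nn i + 1) :=
  Finset.sum_range_succ _ _

theorem offset_mono (nn : ℕ → ℕ) {i j : ℕ} (h : i ≤ j) : offset nn i ≤ offset nn j := by
  induction j, h using Nat.le_induction with
  | base => rfl
  | succ j _ ih => rw [offset_succ]; omega

/-- The words of the input that the simulator reads: the number `m` of rows, for each row the
length `nn i + 1` and the position `q i` of the pivot, and the share `v` of the rows, which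
comes after the input share and the permutations. -/
structure InputSpec (input : List ℕ) (m : ℕ) (nn q v : ℕ → ℕ) : Prop where
  rows : input.getD 1 0 = m
  size : ∀ i < m, input.getD (2 + i) 0 = nn i
  pivot : ∀ i < m, input.getD (2 + m + offset nn m + offset nn m + i) 0 = q i
  share : ∀ k < offset nn m,
    input.getD (2 + m + offset nn m + offset nn m + m + k) 0 = v k
  pivot_le : ∀ i < m, q i ≤ nn i

/-- The registers that hold the parameters once the sizes have been read. -/
def Params (m T N : ℕ) (s : Mach) : Prop :=
  s.reg 0 = 0 ∧ s.reg 1 = 1 ∧ s.reg 2 = m ∧ s.reg 3 = T ∧ s.reg 4 = N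

/-! ### Recovering the shuffled rows -/

theorem exec_seq_pure {p q : Prog} {s s' : Mach} (h : p.exec input s = PMF.pure s') :
    (p ;; q).exec input s = q.exec input s' := by
  rw [Prog.exec, h, PMF.pure_bind]

theorem sizesBody_exec (s : Mach) (h0 : s.reg 0 = 0) (h1 : s.reg 1 = 1) :
    ∃ s', sizesBody.exec input s = PMF.pure s' ∧
      s'.reg 3 = s.reg 3 + (input.getD (s.reg 5) 0 + 1) ∧
      s'.reg 4 = max (s.reg 4) (input.getD (s.reg 5) 0) ∧ s'.reg 5 = s.reg 5 + 1 ∧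
      (∀ r, r < 3 ∨ r = 7 ∨ r = 10 → s'.reg r = s.reg r) ∧ s'.mem = s.mem ∧
      s'.out = s.out ∧ s'.steps = s.steps + 6 := by
  set s1 := ((s.setReg 8 (input.getD (s.reg 5) 0)).setReg 3
    (s.reg 3 + input.getD (s.reg 5) 0)).setReg 3 (s.reg 3 + input.getD (s.reg 5) 0 + 1) with hs1
  have e1 : (Prog.read 8 5 ;; .add 3 3 8 ;; .add 3 3 1).exec input s = PMF.pure s1 := by
    simp only [Prog.exec, PMF.pure_bind]
    congr 1
    simp [hs1, Mach.setReg, h1]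
  obtain ⟨s2, e2, f4, f5, fr, fm, fo, fs⟩ := sizesTail_exec (input := input) s1
    (by simp [hs1, Mach.setReg, h0]) (by simp [hs1, Mach.setReg, h1])
  refine ⟨s2, by rw [sizesBody, exec_seq_pure e1, e2], ?_, ?_, ?_, fun r hr => ?_, ?_, ?_, ?_⟩
  · rw [fr 3 (by omega)]
    simp [hs1, Mach.setReg, add_assoc]
  · rw [f4]
    simp [hs1, Mach.setReg]
  · rw [f5]
    simp [hs1, Mach.setReg]
  · rw [fr r (by omega)]
    have h3 : r ≠ 3 := by omega
    have h8 : r ≠ 8 := by omega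
    simp [hs1, Mach.setReg, h3, h8]
  · simp [fm, hs1, Mach.setReg]
  · simp [fo, hs1, Mach.setReg]
  · simp [fs, hs1, Mach.setReg]

/-- After the preparation the parameters are known, and the final share is in the memory. -/
theorem prepare_exec {m : ℕ} {nn q v : ℕ → ℕ} (hI : InputSpec input m nn q v) :
    ∃ s, prepare.exec input ⟨fun _ => 0, fun _ => 0, [], 0⟩ = PMF.pure s ∧
      Params m (offset nn m) ((Finset.range m).sup nn) s ∧ s.reg 5 = 2 ∧
      s.reg 7 = 0 ∧ s.reg 15 = 2 + m + offset nn m + offset nn m ∧ s.out = [] ∧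
      s.steps = 9 + 6 * m + 4 * offset nn m ∧ ∀ a < offset nn m, s.mem a = v a := by
  set s1 : Mach := ⟨Function.update (Function.update (Function.update (fun _ => 0) 1 1)
    2 m) 5 2, fun _ => 0, [], 3⟩ with hs1
  have e1 : (Prog.const 1 1 ;; .read 2 1 ;; .const 5 2).exec input
      ⟨fun _ => 0, fun _ => 0, [], 0⟩ = PMF.pure s1 := by
    simp only [Prog.exec, PMF.pure_bind]
    simp [hs1, Mach.setReg, ← hI.rows]
  obtain ⟨s2, e2, ⟨⟨a0, a1, a2, a3, a4⟩, a5, a7, a10, ao, as⟩⟩ :=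
    repeatStep_pure (f := sizesBody.exec input) (k := m) (a := { s1 with steps := 4 })
    (I := fun i s => Params m (offset nn i) ((Finset.range i).sup nn) s ∧ s.reg 5 = 2 + i ∧
      s.reg 7 = 0 ∧ s.reg 10 = 0 ∧ s.out = [] ∧ s.steps = 4 + 6 * i)
    (by simp [hs1, Params, offset]) (by
      rintro i s hi ⟨⟨a0, a1, a2, a3, a4⟩, a5, a7, a10, ao, as⟩
      obtain ⟨s', e, f3, f4, f5, fr, fm, fo, fs⟩ := sizesBody_exec (input := input) s a0 a1
      rw [a5, hI.size i hi] at f3 f4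
      refine ⟨s', e, ⟨?_, ?_, ?_, ?_, ?_⟩, ?_, ?_, ?_, ?_, ?_⟩
      · rw [fr 0 (by omega), a0]
      · rw [fr 1 (by omega), a1]
      · rw [fr 2 (by omega), a2]
      · rw [f3, a3, offset_succ]
      · rw [f4, a4, Finset.range_add_one, Finset.sup_insert, max_comm]
      · omega
      · rw [fr 7 (by omega), a7]
      · rw [fr 10 (by omega), a10]
      · rw [fo, ao]
      · omega)
  have e2' : (Prog.loop 2 sizesBody).exec input s1 = PMF.pure s2 := by
    rw [Prog.exec, show s1.reg 2 = m by simp [hs1]]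
    exact e2
  set T := offset nn m with hT
  set s3 : Mach := ((s2.setReg 15 (2 + m + T)).setReg 15 (2 + m + T + T)).setReg 11
    (2 + m + T + T + m) with hs3
  have e3 : (Prog.add 15 5 3 ;; .add 15 15 3 ;; .add 11 15 2).exec input s2 = PMF.pure s3 := by
    simp only [Prog.exec, PMF.pure_bind]
    congr 1
    simp [hs3, Mach.setReg, a2, a3, a5]
  have hs3s : s3.steps = 7 + 6 * m := by simp [hs3, Mach.setReg, as]; omega
  obtain ⟨s4, e4, b11, b10, br, bo, bs, bm⟩ :=
    repeatStep_pure (f := copyBody.exec input) (k := T)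
    (a := { s3 with steps := s3.steps + 1 })
    (I := fun i s => s.reg 11 = 2 + m + T + T + m + i ∧ s.reg 10 = i ∧
      (∀ r, r < 6 ∨ r = 7 ∨ r = 15 → s.reg r = s3.reg r) ∧ s.out = [] ∧
      s.steps = 8 + 6 * m + 4 * i ∧ ∀ a < i, s.mem a = v a)
    (by simp [hs3, Mach.setReg, as, a10, ao]; omega) (by
      rintro i s hi ⟨b11, b10, br, bo, bs, bm⟩
      have b1 : s.reg 1 = 1 := by rw [br 1 (by omega)]; simp [hs3, Mach.setReg, a1]
      simp only [copyBody, Prog.exec, PMF.pure_bind]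
      refine ⟨_, rfl, ?_, ?_, fun r hr => ?_, ?_, ?_, fun a ha => ?_⟩
      · simp [Mach.setReg, b11, b1, add_assoc]
      · simp [Mach.setReg, b10, b1]
      · have h10 : r ≠ 10 := by omega
        have h11 : r ≠ 11 := by omega
        have h13 : r ≠ 13 := by omega
        simp [Mach.setReg, h10, h11, h13, br r hr]
      · simp [Mach.setReg, bo]
      · simp [Mach.setReg, bs]; omega
      · have h := hI.share i hi
        rw [← hT] at h
        by_cases hai : a = i
        · subst hai
          simpa [Mach.setReg, b10, b11] using h
        · simpa [Mach.setReg, b10, hai] using bm a (by omega))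
  have e4' : (Prog.loop 3 copyBody).exec input s3 = PMF.pure s4 := by
    rw [Prog.exec, show s3.reg 3 = T by simp [hs3, Mach.setReg, a3]]
    exact e4
  refine ⟨s4.setReg 5 2, ?_, ⟨?_, ?_, ?_, ?_, ?_⟩, ?_, ?_, ?_, ?_, ?_, ?_⟩
  · rw [prepare, exec_seq_pure e1, exec_seq_pure e2', exec_seq_pure e3,
      exec_seq_pure e4', Prog.exec]
  · simp [Mach.setReg, br 0, hs3, a0]
  · simp [Mach.setReg, br 1, hs3, a1]
  · simp [Mach.setReg, br 2, hs3, a2]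
  · simp [Mach.setReg, br 3, hs3, a3]
  · simp [Mach.setReg, br 4, hs3, a4]
  · simp [Mach.setReg]
  · simp [Mach.setReg, br 7, hs3, a7]
  · simp [Mach.setReg, br 15, hs3]
  · simp [Mach.setReg, bo]
  · simp [Mach.setReg, bs]; omega
  · simpa [Mach.setReg] using bm

/-- The state before row `i` is treated, when the bits of the rows above are given by `B`. -/
structure RowsInv (m : ℕ) (nn v : ℕ → ℕ) (i : ℕ) (B : ℕ → Finset ℕ) (s : Mach) : Prop where
  params : Params m (offset nn m) ((Finset.range m).sup nn) s
  sizePtr : s.reg 5 = 2 + i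
  off : s.reg 7 = offset nn i
  pivotPtr : s.reg 15 = 2 + m + offset nn m + offset nn m + i
  out : s.out = []
  steps : s.steps ≤ 10 + 6 * m + 4 * offset nn m + 14 * offset nn i
  done : ∀ i' < i, ∀ x : Fin (nn i' + 1), s.mem (offset nn i' + x.val) =
    v (offset nn i' + ((protocolPerm (nn i') (B i'))⁻¹ x).val)
  todo : ∀ a, offset nn i ≤ a → a < offset nn m → s.mem a = v a
  bits : ∀ i' < i, ∀ j < nn i',
    s.mem (offset nn m + offset nn i' + j) = if j ∈ B i' then 1 else 0

/-- The treatment of row `i` adds its bit set to the family. -/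
theorem rowBody_coupled {m : ℕ} {nn q v : ℕ → ℕ} (hI : InputSpec input m nn q v) {i : ℕ}
    (hi : i < m) {B : ℕ → Finset ℕ} {s : Mach} (h : RowsInv m nn v i B s) :
    Coupled (subsetPMF (nn i) (q i)) (rowBody.exec input s) fun C s' =>
      RowsInv m nn v (i + 1) (Function.update B i C) s' := by
  obtain ⟨⟨a0, a1, a2, a3, a4⟩, a5, a7, a15, ao, as, hdone, htodo, hbits⟩ := h
  obtain ⟨s1, e1, f8, f9, f10, fr, fo, fs, fm⟩ := rowHead_exec (input := input) s a0
  have hqn := hI.pivot_le i hi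
  have hoff := offset_mono nn (show i + 1 ≤ m from hi)
  rw [offset_succ] at hoff
  rw [a5, hI.size i hi] at f8 f10
  rw [a15, hI.pivot i hi] at f9
  rw [a5, a15, a7, hI.size i hi, hI.pivot i hi] at fm
  have g3 : s1.reg 3 = offset nn m := by rw [fr 3 (by omega), a3]
  have g7 : s1.reg 7 = offset nn i := by rw [fr 7 (by omega), a7]
  have g1 : s1.reg 1 = 1 := by rw [fr 1 (by omega), a1]
  rw [rowBody]
  refine coupled_seq_of_pure e1 (coupled_seq_pure (R := fun C s' =>
      C ⊆ Finset.range (nn i) ∧ C.card = q i ∧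
      (∀ x, x < 9 ∨ x = 15 → s'.reg x = s1.reg x) ∧ s'.out = [] ∧
      s'.steps ≤ s1.steps + 1 + 14 * nn i ∧
      (∀ x : Fin (nn i + 1), s'.mem (offset nn i + x.val) =
        s1.mem (offset nn i + ((roundsPerm (nn i) C (nn i))⁻¹ x).val)) ∧
      (∀ j < nn i, s'.mem (offset nn m + offset nn i + j) = if j ∈ C then 1 else 0) ∧
      (∀ a, ¬ (offset nn i ≤ a ∧ a ≤ offset nn i + nn i) →
        ¬ (offset nn m + offset nn i ≤ a ∧ a < offset nn m + offset nn i + nn i) →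
        s'.mem a = s1.mem a)) ?_ ?_)
  · rw [Prog.exec, f8]
    refine (undo_coupled (s := { s1 with steps := s1.steps + 1 }) le_rfl hqn g1 f9 f10 (by
      simp only [g3, g7]; omega)).mono ?_
    rintro C s' ⟨c1, c2, cr, co, cs, cm, cb, cf⟩
    simp only [g3, g7] at cm cb cf
    exact ⟨c1, c2, cr, by rw [co]; exact fo.trans ao, cs, cm, cb, cf⟩
  · rintro C s2 ⟨c1, c2, cr, co, cs, cm, cb, cf⟩
    have d0 : ∀ x, x < 8 ∨ x = 15 → s2.reg x = s.reg x := fun x hx => by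
      rw [cr x (by omega), fr x hx]
    have d8 : s2.reg 8 = nn i := by rw [cr 8 (by omega), f8]
    have hold : ∀ i' < i, Function.update B i C i' = B i' := fun i' hi' =>
      Function.update_of_ne hi'.ne _ _
    simp only [rowTail, Prog.exec, PMF.pure_bind]
    refine ⟨_, rfl, ⟨?_, ?_, ?_, ?_, ?_⟩, ?_, ?_, ?_, ?_, ?_, fun i' hi' x => ?_,
      fun a ha1 ha2 => ?_, fun i' hi' j hj => ?_⟩
    · simp [Mach.setReg, d0, a0]
    · simp [Mach.setReg, d0, a1]
    · simp [Mach.setReg, d0, a2]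
    · simp [Mach.setReg, d0, a3]
    · simp [Mach.setReg, d0, a4]
    · simp [Mach.setReg, d0, a5, a1, add_assoc]
    · simp [Mach.setReg, d0, a7, a1, d8, offset_succ, add_assoc]
    · simp [Mach.setReg, d0, a15, a1, add_assoc]
    · simp [Mach.setReg, co]
    · simp only [Mach.setReg, offset_succ]
      omega
    · simp only [Mach.setReg]
      by_cases hii : i' = i
      · subst hii
        have hc : countBelow C (nn i') = q i' := by rw [countBelow_eq_card c1, c2]
        rw [cm, fm, update_swap _ _ hqn le_rfl, Function.update_self, protocolPerm, hc,
          mul_inv_rev, Equiv.swap_inv, Equiv.Perm.mul_apply]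
        exact htodo _ (by omega) (by
          have := (Equiv.swap (Fin.ofNat (nn i' + 1) (q i')) (Fin.ofNat (nn i' + 1) (nn i'))
            ((roundsPerm (nn i') C (nn i'))⁻¹ x)).2
          omega)
      · have hlt : i' < i := by omega
        have hle := offset_mono nn (show i' + 1 ≤ i from hlt)
        rw [offset_succ] at hle
        have hx := x.2
        rw [hold i' hlt, cf _ (by omega) (by omega), fm, Function.update_of_ne (by omega),
          Function.update_of_ne (by omega), hdone i' hlt x]
    · rw [offset_succ] at ha1
      simp only [Mach.setReg]
      rw [cf _ (by omega) (by omega), fm, Function.update_of_ne (by omega),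
          Function.update_of_ne (by omega)]
      exact htodo a (by omega) ha2
    · simp only [Mach.setReg]
      by_cases hii : i' = i
      · subst hii
        rw [Function.update_self, cb j hj]
      · have hlt : i' < i := by omega
        have hle := offset_mono nn (show i' + 1 ≤ i from hlt)
        rw [offset_succ] at hle
        rw [hold i' hlt, cf _ (by omega) (by omega), fm, Function.update_of_ne (by omega),
          Function.update_of_ne (by omega), hbits i' hlt j hj]

/-! ### The words of the rounds in the simulation -/

theorem finRange_flatMap_val {m : ℕ} (g : ℕ → List ℕ) :
    ((List.finRange m).flatMap fun i : Fin m => g i) = (List.range m).flatMap g := by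
  rw [← List.map_coe_finRange_eq_range, List.flatMap_map]

/-- The memory cells below the total length, listed row by row. -/
theorem range_offset_map (nn f : ℕ → ℕ) (m : ℕ) :
    (List.range (offset nn m)).map f =
      (List.range m).flatMap fun i => List.ofFn fun x : Fin (nn i + 1) =>
        f (offset nn i + x.val) := by
  induction m with
  | zero => simp [offset]
  | succ m ih =>
    rw [offset_succ, List.range_add, List.map_append, ih, List.range_succ (n := m),
      List.flatMap_append]
    congr 1
    rw [List.flatMap_singleton, List.map_map, List.ofFn_eq_map, ← List.map_coe_finRange_eq_range,
      List.map_map]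
    rfl

theorem seqPMF_map_uniform_bool (m : ℕ) :
    (seqPMF false (fun _ => PMF.uniformOfFintype Bool) m).map (fun f (i : Fin m) => f i) =
      PMF.uniformOfFintype (Fin m → Bool) := by
  have h := seqPMF_map_uniform false (fun _ => Finset.univ) (fun _ => Finset.univ_nonempty) m
    ⟨fun _ => false, by simp⟩
  refine h.trans ?_
  rw [PMF.uniformOfFintype]
  congr

/-- The words of a round with the coins tossed row by row, as the simulator does; the coins of the
inactive rows are tossed too, but not used. -/
theorem roundLog_eq_seqPMF (nn : ℕ → ℕ) (B : ℕ → Finset ℕ) (m j : ℕ) :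
    roundLog (fun i : Fin m => nn i) (fun i => B i) j =
      (seqPMF false (fun _ => PMF.uniformOfFintype Bool) m).map fun f =>
        (List.range m).flatMap fun i =>
          if j < nn i then [(f i).toNat, (xor (f i) (decide (j ∈ B i))).toNat] else [] := by
  rw [roundLog, ← seqPMF_map_uniform_bool, PMF.map_comp]
  congr 1
  funext f
  exact finRange_flatMap_val (m := m) fun i =>
    if j < nn i then [(f i).toNat, (xor (f i) (decide (j ∈ B i))).toNat] else []

/-- The output of a round. -/
theorem roundBody_coupled {m N j : ℕ} {nn q v : ℕ → ℕ} (hI : InputSpec input m nn q v)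
    (B : ℕ → Finset ℕ) {s : Mach} (hp : Params m (offset nn m) N s) (h10 : s.reg 10 = j)
    (hbits : ∀ i < m, ∀ j < nn i,
      s.mem (offset nn m + offset nn i + j) = if j ∈ B i then 1 else 0) :
    Coupled (roundLog (fun i : Fin m => nn i) (fun i => B i) j) (roundBody.exec input s)
      fun l s' => Params m (offset nn m) N s' ∧ s'.reg 10 = j + 1 ∧ s'.mem = s.mem ∧
        s'.out = s.out ++ l ∧ s'.steps ≤ s.steps + (4 + 14 * m) := by
  obtain ⟨a0, a1, a2, a3, a4⟩ := hp
  rw [roundLog_eq_seqPMF]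
  set s1 := (s.setReg 5 2).setReg 7 (offset nn m) with hs1
  have e1 : (Prog.const 5 2 ;; .add 7 3 0).exec input s = PMF.pure s1 := by
    simp [Prog.exec, hs1, Mach.setReg, a0, a3]
  refine Coupled.map_left (coupled_seq_of_pure e1 (coupled_seq_pure (R := fun f s' =>
    (∀ r, r < 5 → s'.reg r = s.reg r) ∧ s'.reg 10 = j ∧ s'.mem = s.mem ∧
      s'.out = s.out ++ ((List.range m).flatMap fun i =>
          if j < nn i then [(f i).toNat, (xor (f i) (decide (j ∈ B i))).toNat] else []) ∧
      s'.steps ≤ s.steps + (3 + 14 * m)) ?_ ?_))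
  · rw [Prog.exec, show s1.reg 2 = m by simp [hs1, Mach.setReg, a2]]
    refine (coupled_seqPMF (R := fun i f s' =>
      (∀ r, r < 5 → s'.reg r = s.reg r) ∧ s'.reg 10 = j ∧ s'.mem = s.mem ∧
      s'.reg 5 = 2 + i ∧ s'.reg 7 = offset nn m + offset nn i ∧
      s'.out = s.out ++ ((List.range i).flatMap fun i =>
          if j < nn i then [(f i).toNat, (xor (f i) (decide (j ∈ B i))).toNat] else []) ∧
      s'.steps ≤ s.steps + (3 + 14 * i)) ?_ ?_).mono
        fun f s' ⟨b1, b2, b3, _, _, b6, b7⟩ => ⟨b1, b2, b3, b6, b7⟩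
    · refine ⟨fun r hr => ?_, ?_⟩
      · have h5 : r ≠ 5 := by omega
        have h7 : r ≠ 7 := by omega
        simp [hs1, Mach.setReg, h5, h7]
      · simp [hs1, Mach.setReg, h10, offset]
    · rintro i f s2 hi ⟨b1, b2, b3, b4, b5, b6, b7⟩
      have c1 : s2.reg 1 = 1 := by rw [b1 1 (by omega), a1]
      set s3 := (s2.setReg 8 (nn i)).setReg 9 (j + 1) with hs3
      have e3 : (Prog.read 8 5 ;; .add 9 10 1).exec input s2 = PMF.pure s3 := by
        simp only [Prog.exec, PMF.pure_bind]
        congr 1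
        simp only [Mach.setReg, b4, hI.size i hi, hs3]
        simp [b2, c1]
      refine coupled_seq_of_pure e3 (coupled_seq_pure
        (coupled_rand_bool (by simp [hs3, Mach.setReg, c1])) ?_)
      rintro r _ rfl
      have d8 : (s3.setReg 16 r.toNat).reg 8 = nn i := by simp [hs3, Mach.setReg]
      have d9 : (s3.setReg 16 r.toNat).reg 9 = j + 1 := by simp [hs3, Mach.setReg]
      have d7 : (s3.setReg 16 r.toNat).reg 7 = offset nn m + offset nn i := by
        simp [hs3, Mach.setReg, b5]
      have d5 : (s3.setReg 16 r.toNat).reg 5 = 2 + i := by simp [hs3, Mach.setReg, b4]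
      have d10 : (s3.setReg 16 r.toNat).reg 10 = j := by simp [hs3, Mach.setReg, b2]
      have dm : (s3.setReg 16 r.toNat).mem = s.mem := by simp [hs3, Mach.setReg, b3]
      have dout : (s3.setReg 16 r.toNat).out = s2.out := by simp [hs3, Mach.setReg]
      have ds : (s3.setReg 16 r.toNat).steps = s2.steps + 3 := by simp [hs3, Mach.setReg]
      obtain ⟨s4, e4, f5, f7, f10, fr, fm, fo, fs⟩ := wordsTail_exec (input := input)
        (s3.setReg 16 r.toNat) (by simp [hs3, Mach.setReg, c1]) r (decide (j ∈ B i))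
        (by simp [Mach.setReg]) (by
          rw [d8, d9, d7, d10, dm]
          intro hj
          rw [hbits i hi j hj]
          by_cases hB : j ∈ B i <;> simp [hB])
      refine ⟨s4, e4, fun x hx => ?_, ?_, ?_, ?_, ?_, ?_, ?_⟩
      · have h8 : x ≠ 8 := by omega
        have h9 : x ≠ 9 := by omega
        have h16 : x ≠ 16 := by omega
        rw [fr x hx, ← b1 x hx]
        simp [hs3, Mach.setReg, h8, h9, h16]
      · rw [f10, d10]
      · rw [fm, dm]
      · rw [f5, d5, add_assoc]
      · rw [f7, d7, d8, offset_succ, add_assoc]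
      · rw [fo, dout, b6, d8, d9, List.range_succ, List.flatMap_append, List.append_assoc]
        congr 2
        · refine List.flatMap_congr fun i' hi' => ?_
          rw [Function.update_of_ne (List.mem_range.1 hi').ne]
        · simp
      · omega
  · rintro f s2 ⟨b1, b2, b3, b4, b5⟩
    refine ⟨_, rfl, ⟨?_, ?_, ?_, ?_, ?_⟩, ?_, ?_, ?_, ?_⟩
    · simp [Mach.setReg, b1, a0]
    · simp [Mach.setReg, b1, a1]
    · simp [Mach.setReg, b1, a2]
    · simp [Mach.setReg, b1, a3]
    · simp [Mach.setReg, b1, a4]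
    · simp [Mach.setReg, b1, b2, a1]
    · simp [Mach.setReg, b3]
    · simp [Mach.setReg, b4]
    · simp only [Mach.setReg]; omega

/-- The memory cells below the total length `T` are put out. -/
theorem finish_exec {m T N : ℕ} {s : Mach} (hp : Params m T N s) :
    ∃ s', finish.exec input s = PMF.pure s' ∧ Params m T N s' ∧ s'.reg 10 = 0 ∧
      s'.mem = s.mem ∧ s'.out = s.out ++ (List.range T).map s.mem ∧
      s'.steps = s.steps + (3 + 3 * T) := by
  obtain ⟨a0, a1, a2, a3, a4⟩ := hp
  obtain ⟨s1, e1, br, b10, bm, bo, bs⟩ :=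
    repeatStep_pure (f := emitBody.exec input) (k := T)
    (a := { s.setReg 10 0 with steps := s.steps + 2 })
    (I := fun i s' => (∀ r, r < 5 → s'.reg r = s.reg r) ∧ s'.reg 10 = i ∧ s'.mem = s.mem ∧
      s'.out = s.out ++ (List.range i).map s.mem ∧ s'.steps = s.steps + (2 + 3 * i))
    (by
      refine ⟨fun r hr => ?_, ?_⟩
      · have h10 : r ≠ 10 := by omega
        simp [Mach.setReg, h10]
      · simp [Mach.setReg]) (by
      rintro i s1 hi ⟨br, b10, bm, bo, bs⟩
      simp only [emitBody, Prog.exec, PMF.pure_bind]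
      refine ⟨_, rfl, fun r hr => ?_, ?_, ?_, ?_, ?_⟩
      · have h10 : r ≠ 10 := by omega
        have h13 : r ≠ 13 := by omega
        simp [Mach.setReg, h10, h13, br r hr]
      · simp [Mach.setReg, b10, br, a1]
      · simp [Mach.setReg, bm]
      · simp [Mach.setReg, bo, bm, b10, List.range_succ]
      · simp [Mach.setReg, bs]; omega)
  have e1' : (Prog.loop 3 emitBody).exec input (s.setReg 10 0) = PMF.pure s1 := by
    rw [Prog.exec, show (s.setReg 10 0).reg 3 = T by simp [Mach.setReg, a3]]
    exact e1
  refine ⟨s1.setReg 10 0, by rw [finish, exec_seq_pure (by rw [Prog.exec]), exec_seq_pure e1',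
    Prog.exec], ⟨?_, ?_, ?_, ?_, ?_⟩, ?_, ?_, ?_, ?_⟩
  · simp [Mach.setReg, br, a0]
  · simp [Mach.setReg, br, a1]
  · simp [Mach.setReg, br, a2]
  · simp [Mach.setReg, br, a3]
  · simp [Mach.setReg, br, a4]
  · simp [Mach.setReg]
  · simp [Mach.setReg, bm]
  · simp [Mach.setReg, bo]
  · simp [Mach.setReg, bs]; omega

/-- The output of the simulator on every input of the expected form, with its running time. -/
theorem program_coupled {m : ℕ} {nn q v : ℕ → ℕ} (hI : InputSpec input m nn q v) :
    Coupled
      ((seqPMF ∅ (fun i => subsetPMF (nn i) (q i)) m).bind fun B =>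
        (roundsLog (fun i : Fin m => nn i) (fun i => B i) ((Finset.range m).sup nn)).map fun l =>
          ((List.range m).flatMap fun i => List.ofFn fun x : Fin (nn i + 1) =>
            v (offset nn i + ((protocolPerm (nn i) (B i))⁻¹ x).val)) ++ l)
      (program.run input) fun l s => s.out = l ∧
        s.steps ≤ 14 + 6 * m + 21 * offset nn m + ((Finset.range m).sup nn) * (4 + 14 * m) := by
  obtain ⟨s1, e1, hp, h5, h7, h15, ho, hs, hm⟩ := prepare_exec hI
  rw [Prog.run, program]
  refine coupled_seq_of_pure e1 ?_
  rw [Prog.exec, Prog.exec, hp.2.2.1]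
  refine (coupled_seqPMF (R := RowsInv m nn v) ?_ ?_).bind ?_
  · exact ⟨hp, h5, by simpa [offset] using h7, by simpa using h15, ho, by simp only [hs]; omega,
      fun i' hi' => absurd hi' (Nat.not_lt_zero _), fun a _ ha => hm a ha,
      fun i' hi' => absurd hi' (Nat.not_lt_zero _)⟩
  · intro i B s hi h
    exact rowBody_coupled hI hi h
  rintro B s2 ⟨hp2, -, -, -, ho2, hs2, hdone, -, hbits⟩
  obtain ⟨s3, e3, hp3, h10, hm3, ho3, hs3⟩ := finish_exec (input := input) hp2
  have hout : s3.out = (List.range m).flatMap fun i => List.ofFn fun x : Fin (nn i + 1) =>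
      v (offset nn i + ((protocolPerm (nn i) (B i))⁻¹ x).val) := by
    rw [ho3, ho2, List.nil_append, range_offset_map]
    refine List.flatMap_congr fun i hi => ?_
    exact congrArg List.ofFn (funext fun x => hdone i (List.mem_range.1 hi) x)
  refine Coupled.map_left (coupled_seq_of_pure e3 ?_)
  rw [Prog.exec, hp3.2.2.2.2, ← hout]
  set N := (Finset.range m).sup nn
  have key : ∀ k, Coupled (roundsLog (fun i : Fin m => nn i) (fun i => B i) k)
      (repeatStep (roundBody.exec input) k { s3 with steps := s3.steps + 1 }) fun l s' =>
        Params m (offset nn m) N s' ∧ s'.reg 10 = k ∧ s'.mem = s3.mem ∧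
        s'.out = s3.out ++ l ∧ s'.steps ≤ s3.steps + 1 + k * (4 + 14 * m) := by
    intro k
    induction k with
    | zero => exact Coupled.pure ⟨hp3, h10, rfl, by simp, by simp⟩
    | succ k ih =>
      rw [repeatStep_succ_last, roundsLog]
      refine ih.bind ?_
      rintro l s4 ⟨hp4, h10, hm4, ho4, hs4⟩
      refine Coupled.map_left ((roundBody_coupled hI B hp4 h10 (by
        rw [hm4, hm3]; exact hbits)).mono ?_)
      rintro l' s5 ⟨hp5, h10, hm5, ho5, hs5⟩
      refine ⟨hp5, h10, by rw [hm5, hm4], by rw [ho5, ho4, List.append_assoc], ?_⟩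
      rw [add_mul, one_mul]
      omega
  refine (key N).mono ?_
  rintro l s4 ⟨-, -, -, ho4, hs4⟩
  exact ⟨ho4, by omega⟩

/-! ### The simulator on its input -/

theorem length_flatMap_range {nn : ℕ → ℕ} {L : ℕ → List ℕ} {m : ℕ}
    (hL : ∀ i < m, (L i).length = nn i + 1) :
    ((List.range m).flatMap L).length = offset nn m := by
  induction m with
  | zero => simp [offset]
  | succ m ih =>
    rw [List.range_succ, List.flatMap_append, List.length_append,
      ih fun i hi => hL i (by omega), offset_succ, List.flatMap_singleton, hL m m.lt_succ_self]

theorem getD_flatMap_range {nn : ℕ → ℕ} {L : ℕ → List ℕ} {m : ℕ}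
    (hL : ∀ i < m, (L i).length = nn i + 1) {i x : ℕ} (hi : i < m) (hx : x < nn i + 1) :
    ((List.range m).flatMap L).getD (offset nn i + x) 0 = (L i).getD x 0 := by
  induction m with
  | zero => omega
  | succ m ih =>
    have hlen := length_flatMap_range (m := m) (L := L) fun i hi => hL i (by omega)
    rw [List.range_succ, List.flatMap_append]
    by_cases him : i = m
    · subst him
      rw [List.getD_append_right _ _ _ _ (by omega), hlen, Nat.add_sub_cancel_left,
        List.flatMap_singleton]
    · have := offset_mono nn (show i + 1 ≤ m by omega)
      rw [offset_succ] at this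
      rw [List.getD_append _ _ _ _ (by omega), ih (fun i hi => hL i (by omega)) (by omega)]

variable {w m : ℕ} {n : Fin m → ℕ}

/-- The extension of a family by zeros. -/
def extend {m : ℕ} (f : Fin m → ℕ) (i : ℕ) : ℕ := if h : i < m then f ⟨i, h⟩ else 0

theorem extend_val (f : Fin m → ℕ) (i : Fin m) : extend f i = f i := by simp [extend]

theorem extend_of_lt (f : Fin m → ℕ) {i : ℕ} (h : i < m) : extend f i = f ⟨i, h⟩ := by
  simp [extend, h]

theorem flatMap_ofFn_eq (f : (i : Fin m) → Fin (n i + 1) → ℕ) :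
    ((List.finRange m).flatMap fun i => List.ofFn (f i)) =
      (List.range m).flatMap fun i => if h : i < m then List.ofFn (f ⟨i, h⟩) else [] := by
  rw [← finRange_flatMap_val]
  simp

theorem length_words (f : (i : Fin m) → Fin (n i + 1) → ℕ) :
    ((List.finRange m).flatMap fun i => List.ofFn (f i)).length = offset (extend n) m := by
  rw [flatMap_ofFn_eq]
  exact length_flatMap_range fun i hi => by simp [hi, extend_of_lt n hi]

theorem getD_words (f : (i : Fin m) → Fin (n i + 1) → ℕ) (i : Fin m) (x : Fin (n i + 1)) :
    ((List.finRange m).flatMap fun i => List.ofFn (f i)).getD (offset (extend n) i + x) 0 =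
      f i x := by
  rw [flatMap_ofFn_eq, getD_flatMap_range (fun i hi => by simp [hi, extend_of_lt n hi]) i.2
    (by rw [extend_val]; exact x.2)]
  simp [-List.ofFn_succ, Nat.le_of_lt_succ x.2]

theorem length_simInput (b : Bool) (D : Bool → Rows w n) (πb : RowPerms n) (o : Output w n) :
    (simInput b D πb o).length = 2 + m + offset (extend n) m + offset (extend n) m + m +
      offset (extend n) m := by
  simp only [simInput, List.length_append, List.length_ofFn, rowWords, permWords, length_words]
  rfl

theorem inputSpec_simInput (b : Bool) (D : Bool → Rows w n) (πb : RowPerms n) (o : Output w n) :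
    InputSpec (simInput b D πb o) m (extend n) (extend fun i => (o.q i).val)
      (fun k => (rowWords (o.share b)).getD k 0) := by
  have hD : (rowWords (D b)).length = offset (extend n) m := length_words _
  have hπ : (permWords πb).length = offset (extend n) m := length_words _
  have h1 : ([w, m] ++ List.ofFn n).length = 2 + m := by simp; omega
  have h2 : ([w, m] ++ List.ofFn n ++ rowWords (D b) ++ permWords πb).length =
      2 + m + offset (extend n) m + offset (extend n) m := by
    rw [List.length_append, List.length_append, h1, hD, hπ]
  have h3 : ([w, m] ++ List.ofFn n ++ rowWords (D b) ++ permWords πb ++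
      List.ofFn fun i => (o.q i).val).length =
      2 + m + offset (extend n) m + offset (extend n) m + m := by
    rw [List.length_append, h2, List.length_ofFn]
  refine ⟨by simp [simInput], fun i hi => ?_, fun i hi => ?_, fun k hk => ?_, fun i hi => ?_⟩
  · rw [simInput, List.getD_append _ _ _ _ (by rw [h3]; omega),
      List.getD_append _ _ _ _ (by rw [h2]; omega),
      List.getD_append _ _ _ _ (by rw [List.length_append, h1]; omega),
      List.getD_append _ _ _ _ (by rw [h1]; omega),
      List.getD_append_right _ _ _ _ (by simp), extend_of_lt n hi]
    simp [hi]
  · rw [simInput, List.getD_append _ _ _ _ (by rw [h3]; omega),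
      List.getD_append_right _ _ _ _ (by rw [h2]; omega), h2, Nat.add_sub_cancel_left,
      extend_of_lt _ hi]
    simp [hi]
  · rw [simInput, List.getD_append_right _ _ _ _ (by rw [h3]; omega), h3, Nat.add_sub_cancel_left]
  · rw [extend_of_lt _ hi, extend_of_lt _ hi]
    exact Nat.le_of_lt_succ (o.q _).2

theorem sup_extend (n : Fin m → ℕ) : (Finset.range m).sup (extend n) = Finset.univ.sup n := by
  refine le_antisymm (Finset.sup_le fun i hi => ?_) (Finset.sup_le fun i _ => ?_)
  · rw [extend_of_lt n (Finset.mem_range.1 hi)]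
    exact Finset.le_sup (f := n) (Finset.mem_univ _)
  · rw [← extend_val n i]
    exact Finset.le_sup (f := extend n) (Finset.mem_range.2 i.2)

theorem sup_le_offset (nn : ℕ → ℕ) (m : ℕ) : (Finset.range m).sup nn ≤ offset nn m :=
  Finset.sup_le fun i hi => by
    have := offset_mono nn (show i + 1 ≤ m from Finset.mem_range.1 hi)
    rw [offset_succ] at this
    omega

/-- The words of row shares that are permuted row by row. -/
theorem undone_words (A : Rows w n) (B : ℕ → Finset ℕ) :
    ((List.range m).flatMap fun i => List.ofFn fun x : Fin (extend n i + 1) =>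
      (rowWords A).getD (offset (extend n) i +
        ((protocolPerm (extend n i) (B i))⁻¹ x).val) 0) =
      rowWords fun i => A i ∘ ⇑(protocolPerm (n i) (B i))⁻¹ := by
  rw [← finRange_flatMap_val, rowWords]
  refine List.flatMap_congr fun i _ => ?_
  have key : ∀ N, N = n i → (List.ofFn fun x : Fin (N + 1) =>
      (rowWords A).getD (offset (extend n) i + ((protocolPerm N (B i))⁻¹ x).val) 0) =
      List.ofFn fun k => ((A i ∘ ⇑(protocolPerm (n i) (B i))⁻¹) k).val := by
    rintro _ rfl
    exact congrArg List.ofFn (funext fun x => getD_words (fun i k => (A i k).val) i _)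
  exact key _ (extend_val n i)

theorem seqPMF_congr {α : Type} {d : α} {t t' : ℕ → PMF α} {m : ℕ} (h : ∀ i < m, t i = t' i) :
    seqPMF d t m = seqPMF d t' m := by
  induction m with
  | zero => rfl
  | succ m ih => rw [seqPMF, seqPMF, ih fun i hi => h i (by omega), h m m.lt_succ_self]

/-- The bit sets sampled row by row are uniformly random among those of the prescribed sizes. -/
theorem seqPMF_subsetPMF (q : RowIndices n) :
    (seqPMF ∅ (fun i => subsetPMF (extend n i) (extend (fun i => (q i).val) i)) m).map
        (fun B (i : Fin m) => B i) =
      PMF.uniformOfFinset (bitSets q) (bitSets_nonempty q) := by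
  have hle : ∀ i, extend (fun i => (q i).val) i ≤ extend n i := by
    intro i
    unfold extend
    split_ifs with h
    · exact Nat.le_of_lt_succ (q _).2
    · exact le_rfl
  have hs : (Fintype.piFinset fun i : Fin m =>
      Finset.powersetCard (extend (fun i => (q i).val) i) (Finset.range (extend n i))) =
      bitSets q := by
    simp only [extend_val]
    rfl
  have := seqPMF_map_uniform ∅ (fun i => Finset.powersetCard (extend (fun i => (q i).val) i)
    (Finset.range (extend n i))) (fun i => powersetCard_range_nonempty (hle i)) m
    (hs ▸ bitSets_nonempty q)
  simp only [hs] at this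
  rw [← this]
  congr 1
  exact seqPMF_congr fun i _ => subsetPMF_eq _ _ (hle i)

/-- The simulator produces the view of the real execution, given the output. -/
theorem program_run (b : Bool) (D : Bool → Rows w n) (πb : RowPerms n) (o : Output w n) :
    (program.run (simInput b D πb o)).map (fun s => s.out) =
      (PMF.uniformOfFinset (bitSets o.q) (bitSets_nonempty _)).bind fun B =>
        (roundsLog n B (Finset.univ.sup n)).map fun l =>
          rowWords (fun i => o.share b i ∘ ⇑(protocolPerm (n i) (B i))⁻¹) ++ l := by
  have h := (program_coupled (inputSpec_simInput b D πb o)).map_eq id (fun s => s.out)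
    fun l s h => h.1.symm
  rw [← h, PMF.map_id, ← seqPMF_subsetPMF, PMF.bind_map]
  have hn : (fun i : Fin m => extend n i) = n := funext (extend_val n)
  simp only [hn, sup_extend, undone_words]
  rfl

/-- The time is dominated by the at most `T` rounds over `m` rows each, for the total length `T`;
both `T` and `m` are bounded by the length of the input. -/
theorem program_runsWithin (b : Bool) (D : Bool → Rows w n) (πb : RowPerms n) (o : Output w n) :
    program.RunsWithin (simInput b D πb o)
      ((14 * (Polynomial.X + 1) ^ 2 : Polynomial ℕ).eval (simInput b D πb o).length) := by
  intro s hs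
  obtain ⟨l, -, h⟩ := (program_coupled (inputSpec_simInput b D πb o)).forall_right hs
  refine h.trans ?_
  have hN := Nat.mul_le_mul_right (4 + 14 * m) (sup_le_offset (extend n) m)
  have he : (14 * (Polynomial.X + 1) ^ 2 : Polynomial ℕ).eval (simInput b D πb o).length =
      14 * ((simInput b D πb o).length + 1) ^ 2 := by
    simp [Polynomial.eval_mul, Polynomial.eval_pow, Polynomial.eval_add]
  rw [he, length_simInput]
  refine (Nat.add_le_add_left hN _).trans ?_
  generalize offset (extend n) m = T
  nlinarith [Nat.zero_le (T * m), Nat.zero_le (T * T), Nat.zero_le (m * m)]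

end Simulator

end RowPartition

theorem theorem3 (b : Bool) :
    (∃ (sim : RowPartition.Prog) (P : Polynomial ℕ),
      ∀ (w m : ℕ) (n : Fin m → ℕ) (D : Bool → RowPartition.Rows w n)
        (πb : RowPartition.RowPerms n),
        (∀ o : RowPartition.Output w n,
          sim.RunsWithin (RowPartition.simInput b D πb o)
            (P.eval (RowPartition.simInput b D πb o).length)) ∧
        RowPartition.realWorld b D πb = RowPartition.idealWorld sim b D πb) ∧
    (∀ (w m : ℕ) (n : Fin m → ℕ) (D : Bool → RowPartition.Rows w n),
      (∀ i, Function.Injective (RowPartition.plain D i)) →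
      (RowPartition.idealPartition D).map (fun o => (o.q, o.share b)) =
        PMF.uniformOfFintype (RowPartition.RowIndices n × RowPartition.Rows w n)) := by
  -- the same program serves for both servers
  refine ⟨⟨RowPartition.Simulator.program, 14 * (Polynomial.X + 1) ^ 2, fun w m n D πb =>
    ⟨fun o => RowPartition.Simulator.program_runsWithin b D πb o, ?_⟩⟩,
    fun w m n D hD => RowPartition.idealPartition_map_uniform b D hD⟩
  rw [RowPartition.realWorld_eq, RowPartition.idealWorld]
  congr 1
  funext o
  rw [← RowPartition.Simulator.program_run b D πb o, PMF.map_comp]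
  rfl
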